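/- Let $d\ge 4$ be an integer. For $p>0$ and $x\in\mathbb R^d$ write $\|x\|_p=\bigl(\sum_{i=1}^d|x_i|^p\bigr)^{1/p}$, let \[ V^*=\Bigl\{x\in\mathbb R^d:\ x\neq 0,\ \sum_{i=1}^d x_i=0\Bigr\}, \] and put \[ A_p=2^{1/p-1/2},\qquad B_{d,p}=\left(\frac{(d-1)^{p/2}+(d-1)^{1-p/2}}{d^{p/2}}\right)^{1/p}. \] Call $x$ of edge type if it is, up to a permutation of the coordinates and a nonzero real factor, the vector $(1,-1,0,\dots,0)$, and of vertex type if it is, in the same sense, the vector $(d-1,-1,\dots,-1)$. Then: (1) For every $0<p\le 1$, $\displaystyle\min_{x\in V^*}\frac{\|x\|_p}{\|x\|_2}=A_p$, and the minimisers in $V^*$ are exactly the vectors of edge type. (2) For every $1<p<2$, $\displaystyle\min_{x\in V^*}\frac{\|x\|_p}{\|x\|_2}=\min\{A_p,B_{d,p}\}$, and the minimisers in $V^*$ are exactly the vectors of edge type if $A_p<B_{d,p}$, exactly those of vertex type if $A_p>B_{d,p}$, and exactly those of either type if $A_p=B_{d,p}$. (3) For every $2<q<\infty$, $\displaystyle\max_{x\in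 V^*}\frac{\|x\|_q}{\|x\|_2}=\max\{A_q,B_{d,q}\}$, and the maximisers in $V^*$ are exactly the vectors of edge type if $A_q>B_{d,q}$, exactly those of vertex type if $A_q<B_{d,q}$, and exactly those of either type if $A_q=B_{d,q}$. In particular all the minima and maxima are attained. -/

import Mathlib

open Finset

noncomputable section

namespace ZeroSum

/-- The `ℓ_p` (quasi-)norm `(∑ i, |x i| ^ p) ^ (1 / p)` of a vector of `ℝ^d` (used for `p > 0`). -/
def lpQuasiNorm {d : ℕ} (p : ℝ) (x : Fin d → ℝ) : ℝ :=
  (∑ i, |x i| ^ p) ^ (1 / p)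

/-- The quotient `‖x‖_p / ‖x‖_2`. -/
def ratio {d : ℕ} (p : ℝ) (x : Fin d → ℝ) : ℝ :=
  lpQuasiNorm p x / lpQuasiNorm 2 x

/-- The nonzero vectors of `ℝ^d` with zero coordinate sum. -/
def admissible (d : ℕ) : Set (Fin d → ℝ) :=
  {x | x ≠ 0 ∧ ∑ i, x i = 0}

/-- The vector `(1, -1, 0, …, 0)`. -/
def edgeVector (d : ℕ) : Fin d → ℝ := fun i =>
  if (i : ℕ) = 0 then 1 else if (i : ℕ) = 1 then -1 else 0

/-- The vector `(d - 1, -1, …, -1)`. -/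
def vertexVector (d : ℕ) : Fin d → ℝ := fun i =>
  if (i : ℕ) = 0 then (d : ℝ) - 1 else -1

/-- `x` agrees with `v` up to a permutation of the coordinates and a nonzero real factor. -/
def Equivalent {d : ℕ} (x v : Fin d → ℝ) : Prop :=
  ∃ t : ℝ, t ≠ 0 ∧ ∃ σ : Equiv.Perm (Fin d), ∀ i, x i = t * v (σ i)

/-- `2 ^ (1/p - 1/2)`. -/
def edgeValue (p : ℝ) : ℝ :=
  (2 : ℝ) ^ (1 / p - 1 / 2)

/-- `(((d-1)^(p/2) + (d-1)^(1-p/2)) / d^(p/2)) ^ (1/p)`. -/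
def vertexValue (d : ℕ) (p : ℝ) : ℝ :=
  ((((d : ℝ) - 1) ^ (p / 2) + ((d : ℝ) - 1) ^ (1 - p / 2)) / (d : ℝ) ^ (p / 2)) ^ (1 / p)

end ZeroSum

end

/-! For `p ≤ 1`, let `S` be half the ℓ₁ norm. Zero sum gives `|x l| ≤ S`, so the power sum is at
least `2 S ^ p` and the square sum at most `2 S ^ 2`; equality forces every `|x l|` into `{0, S}`.

For the other exponents put `k = q - 1`; the factor `q - 2 = k - 1` treats minima and maxima
together. A compactness argument gives an extremal vector. By Lagrange its coordinates are abscissae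
where the odd power `|t| ^ (k - 1) * t` meets a line `a + b t` with `b > 0`, and the second
variation forbids repeating a nonzero coordinate at which the power has slope beyond `b` (above if
`k > 1`, below if `k < 1`). If `a = 0`, this leaves one positive and one negative coordinate: edge
type. Otherwise, replacing `x` by `-x`, assume `(k - 1) a > 0`. Then there is one positive root, and
it is simple; there are at most two negative roots, and the one farther from `0` cannot be repeated.
So `x` is a multiple of `(r + m, -r, -1, …, -1)` with `m = d - 2` and `r ≥ 1`, and `r = 1` is the
vertex type.

To exclude `r > 1`, note that the three values lie on one line only if `collinearityDefect`
vanishes, and that this function also gives the sign of the derivative of the normalized power sum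
along the family. If `(k - 1) m ≥ 2` it is negative for all `r > 1`. If `(k - 1) m < 2`, then `k -
1` times it is strictly convex on `[1, ∞)` and zero at `1`, so after a zero `r > 1` it stays
positive: increasing `r` improves the vector, contradicting extremality. -/

namespace ZeroSum

/-! ### Convexity and sign of the collinearity defect -/

/-- The determinant expressing that the points of the odd power function `t ↦ |t| ^ (k - 1) * t`
over `-(r + m)`, `1` and `r` are collinear. -/
noncomputable def collinearityDefect (k m r : ℝ) : ℝ :=
  (r + m + 1) * r ^ k - (r - 1) * (r + m) ^ k - (2 * r + m)

lemma collinearityDefect_one (k m : ℝ) : collinearityDefect k m 1 = 0 := by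
  simp [collinearityDefect]; ring

lemma hasDerivAt_collinearityDefect (k : ℝ) {m r : ℝ} (hm : 0 ≤ m) (hr : 0 < r) :
    HasDerivAt (collinearityDefect k m)
      (r ^ k + (r + m + 1) * (k * r ^ (k - 1)) -
        ((r + m) ^ k + (r - 1) * (k * (r + m) ^ (k - 1))) - 2) r := by
  have h1 : HasDerivAt (fun r : ℝ => r ^ k) (k * r ^ (k - 1)) r :=
    Real.hasDerivAt_rpow_const (Or.inl hr.ne')
  have h2 : HasDerivAt (fun r : ℝ => (r + m) ^ k) (1 * k * (r + m) ^ (k - 1)) r :=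
    ((hasDerivAt_id' r).add_const m).rpow_const (Or.inl (by positivity))
  have h3 : HasDerivAt (fun r : ℝ => r + m + 1) 1 r :=
    ((hasDerivAt_id' r).add_const m).add_const 1
  have h4 : HasDerivAt (fun r : ℝ => r - 1) 1 r := (hasDerivAt_id' r).sub_const 1
  have h5 : HasDerivAt (fun r : ℝ => 2 * r + m) 2 r := by
    simpa using ((hasDerivAt_id' r).const_mul 2).add_const m
  exact (((h3.mul h1).sub (h4.mul h2)).sub h5).congr_deriv (by ring)

/-- The factored form isolates two power terms, so that the sign can be read from a comparison of
logarithms. -/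
lemma deriv2_collinearityDefect (k : ℝ) {m r : ℝ} (hm : 0 ≤ m) (hr : 0 < r) :
    deriv^[2] (collinearityDefect k m) r =
      k * (r ^ (k - 2) * ((k + 1) * r + (k - 1) * (m + 1)) -
        (r + m) ^ (k - 2) * ((k + 1) * r + (2 * m - k + 1))) := by
  have hev : deriv (collinearityDefect k m) =ᶠ[nhds r] fun r =>
      r ^ k + (r + m + 1) * (k * r ^ (k - 1)) -
        ((r + m) ^ k + (r - 1) * (k * (r + m) ^ (k - 1))) - 2 := by
    filter_upwards [lt_mem_nhds hr] with s hs
    exact (hasDerivAt_collinearityDefect k hm hs).deriv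
  simp only [Function.iterate_succ, Function.iterate_zero, Function.comp, id]
  rw [hev.deriv_eq]
  have hp : ∀ j : ℝ, HasDerivAt (fun r : ℝ => r ^ j) (j * r ^ (j - 1)) r := fun j =>
    Real.hasDerivAt_rpow_const (Or.inl hr.ne')
  have hq : ∀ j : ℝ, HasDerivAt (fun r : ℝ => (r + m) ^ j) (1 * j * (r + m) ^ (j - 1)) r :=
    fun j => ((hasDerivAt_id' r).add_const m).rpow_const (Or.inl (by positivity))
  have h3 : HasDerivAt (fun r : ℝ => r + m + 1) 1 r :=
    ((hasDerivAt_id' r).add_const m).add_const 1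
  have h4 : HasDerivAt (fun r : ℝ => r - 1) 1 r := (hasDerivAt_id' r).sub_const 1
  have h := ((((hp k).add (h3.mul ((hp (k - 1)).const_mul k))).sub
    ((hq k).add (h4.mul ((hq (k - 1)).const_mul k)))).sub_const 2).deriv
  refine h.trans ?_
  have e1 : r ^ (k - 1) = r ^ (k - 2) * r := by
    rw [← Real.rpow_add_one hr.ne']; ring_nf
  have e2 : (r + m) ^ (k - 1) = (r + m) ^ (k - 2) * (r + m) := by
    rw [← Real.rpow_add_one (by positivity)]; ring_nf
  have e3 : k - 1 - 1 = k - 2 := by ring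
  simp only [e3, e1, e2]
  ring

/-- The logarithm of the quotient of the two terms of the second derivative of
`collinearityDefect`. -/
noncomputable def curvatureLogRatio (k m r : ℝ) : ℝ :=
  (2 - k) * (Real.log (r + m) - Real.log r) +
    (Real.log ((k + 1) * r + (k - 1) * (m + 1)) - Real.log ((k + 1) * r + (2 * m - k + 1)))

lemma tendsto_log_affine_ratio {c : ℝ} (hc : 0 < c) (a b : ℝ) :
    Filter.Tendsto (fun r => Real.log (c * r + a) - Real.log (c * r + b)) Filter.atTop (nhds 0) := by
  have hlin : ∀ a : ℝ, Filter.Tendsto (fun r => Real.log (c * r + a) - Real.log r)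
      Filter.atTop (nhds (Real.log c)) := by
    intro a
    have h1 : Filter.Tendsto (fun r : ℝ => c + a * r⁻¹) Filter.atTop (nhds (c + a * 0)) :=
      tendsto_const_nhds.add (tendsto_inv_atTop_zero.const_mul a)
    rw [mul_zero, add_zero] at h1
    refine ((Real.continuousAt_log hc.ne').tendsto.comp h1).congr' ?_
    filter_upwards [Filter.eventually_gt_atTop 0, Filter.eventually_gt_atTop (-a / c)] with r hr hr'
    have : 0 < c * r + a := by
      rw [div_lt_iff₀ hc] at hr'; linarith
    rw [← Real.log_div this.ne' hr.ne', Function.comp]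
    congr 1
    field_simp
  simpa using (hlin a).sub (hlin b)

lemma tendsto_curvatureLogRatio {k : ℝ} (hk : 0 < k) (m : ℝ) :
    Filter.Tendsto (curvatureLogRatio k m) Filter.atTop (nhds 0) := by
  have h1 := (tendsto_log_affine_ratio one_pos m 0).const_mul (2 - k)
  have h2 := tendsto_log_affine_ratio (by linarith : 0 < k + 1) ((k - 1) * (m + 1)) (2 * m - k + 1)
  have h := h1.add h2
  simp only [mul_zero, add_zero, one_mul] at h
  exact h

/-- The function tends to `0` at infinity and is strictly decreasing, because its derivative is a
rational function whose numerator is negative exactly thanks to `(k - 1) m ≤ 2` and `k < 2`. -/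
lemma mul_curvatureLogRatio_pos {k m r : ℝ} (hk0 : 0 < k) (hk2 : k < 2) (hk1 : k ≠ 1)
    (hm : 2 ≤ m) (hkm : (k - 1) * m ≤ 2) (hr : 1 ≤ r)
    (hpos : 0 < (k + 1) * r + (k - 1) * (m + 1)) :
    0 < (k - 1) * curvatureLogRatio k m r := by
  have hsq : 0 < (k - 1) ^ 2 := by
    have := sub_ne_zero.mpr hk1
    positivity
  have hA : ∀ s ∈ Set.Ici r, 0 < (k + 1) * s + (k - 1) * (m + 1) := fun s hs => by
    have : r ≤ s := hs
    nlinarith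
  have hB : ∀ s ∈ Set.Ici r, 0 < (k + 1) * s + (2 * m - k + 1) := fun s hs => by
    have : r ≤ s := hs
    nlinarith
  have hder : ∀ s ∈ Set.Ici r, HasDerivAt (fun s => (k - 1) * curvatureLogRatio k m s)
      ((k - 1) * ((2 - k) * (1 / (s + m) - 1 / s) +
        ((k + 1) / ((k + 1) * s + (k - 1) * (m + 1)) -
          (k + 1) / ((k + 1) * s + (2 * m - k + 1))))) s := by
    intro s hs
    have hrs : r ≤ s := hs
    have hlin : ∀ a : ℝ, HasDerivAt (fun s => (k + 1) * s + a) (k + 1) s := fun a => by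
      simpa using ((hasDerivAt_id' s).const_mul (k + 1)).add_const a
    have h1 : HasDerivAt (fun s : ℝ => Real.log (s + m)) (1 / (s + m)) s :=
      ((hasDerivAt_id' s).add_const m).log (by linarith)
    have h2 : HasDerivAt (fun s : ℝ => Real.log s) (1 / s) s :=
      (hasDerivAt_id' s).log (by linarith)
    exact (((h1.sub h2).const_mul (2 - k)).add
      (((hlin _).log (hA s hs).ne').sub ((hlin _).log (hB s hs).ne'))).const_mul (k - 1)
  have hanti : StrictAntiOn (fun s => (k - 1) * curvatureLogRatio k m s) (Set.Ici r) := by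
    refine strictAntiOn_of_deriv_neg (convex_Ici r)
      (fun s hs => (hder s hs).continuousAt.continuousWithinAt) fun s hs => ?_
    rw [interior_Ici] at hs
    have hs' : s ∈ Set.Ici r := Set.Ioi_subset_Ici_self hs
    have hrs : r ≤ s := hs'
    have hs0 : 0 < s := by linarith
    have hsm : 0 < s + m := by linarith
    have h1 := hA s hs'
    have h2 := hB s hs'
    rw [(hder s hs').deriv]
    have key : (k - 1) * ((2 - k) * (1 / (s + m) - 1 / s) +
        ((k + 1) / ((k + 1) * s + (k - 1) * (m + 1)) -
          (k + 1) / ((k + 1) * s + (2 * m - k + 1)))) =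
        (k - 1) ^ 2 * ((k + 1) * (m * (k - 1) - 2) * (s ^ 2 + m * s) -
          (2 - k) * m * (m + 1) * (2 * m - k + 1)) /
        (s * (s + m) * ((k + 1) * s + (k - 1) * (m + 1)) * ((k + 1) * s + (2 * m - k + 1))) := by
      generalize hA' : (k + 1) * s + (k - 1) * (m + 1) = A at h1
      generalize hB' : (k + 1) * s + (2 * m - k + 1) = B at h2
      field_simp
      rw [← hA', ← hB']
      ring
    rw [key]
    refine div_neg_of_neg_of_pos (mul_neg_of_pos_of_neg hsq ?_) (by positivity)
    have h3 : 0 < (2 - k) * m * (m + 1) * (2 * m - k + 1) :=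
      mul_pos (mul_pos (mul_pos (by linarith) (by linarith)) (by linarith)) (by linarith)
    have h4 : (k + 1) * (m * (k - 1) - 2) * (s ^ 2 + m * s) ≤ 0 :=
      mul_nonpos_of_nonpos_of_nonneg
        (mul_nonpos_of_nonneg_of_nonpos (by linarith) (by linarith)) (by positivity)
    linarith
  have hlim : Filter.Tendsto (fun s => (k - 1) * curvatureLogRatio k m s) Filter.atTop (nhds 0) := by
    simpa using (tendsto_curvatureLogRatio hk0 m).const_mul (k - 1)
  have hr1 : r + 1 ∈ Set.Ici r := by simp
  have h0 : 0 ≤ (k - 1) * curvatureLogRatio k m (r + 1) := by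
    refine le_of_tendsto hlim ?_
    filter_upwards [Filter.eventually_ge_atTop (r + 1)] with s hs
    exact hanti.antitoneOn hr1 (Set.mem_Ici.mpr (by linarith)) hs
  exact h0.trans_lt (hanti Set.self_mem_Ici hr1 (by linarith))

lemma mul_deriv2_collinearityDefect_pos {k m r : ℝ} (hk0 : 0 < k) (hk2 : k < 2) (hk1 : k ≠ 1)
    (hm : 2 ≤ m) (hkm : (k - 1) * m ≤ 2) (hr : 1 ≤ r) :
    0 < (k - 1) * deriv^[2] (collinearityDefect k m) r := by
  have hr0 : 0 < r := by linarith
  have hrm : 0 < r + m := by linarith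
  have hB : 0 < (k + 1) * r + (2 * m - k + 1) := by nlinarith
  have hU := Real.rpow_pos_of_pos hrm (k - 2)
  have hR := Real.rpow_pos_of_pos hr0 (k - 2)
  rw [deriv2_collinearityDefect k (by linarith) hr0]
  -- If the first affine factor is not positive, its logarithm is useless, but then `k < 1` and both
  -- terms push the second derivative below zero.
  rcases le_or_gt ((k + 1) * r + (k - 1) * (m + 1)) 0 with hA | hA
  · have hk : k < 1 := by
      by_contra h
      push Not at h
      nlinarith [mul_nonneg (sub_nonneg.mpr h) (by linarith : 0 ≤ m + 1)]
    have h1 := mul_pos hU hB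
    have h2 := mul_nonpos_of_nonneg_of_nonpos hR.le hA
    exact mul_pos_of_neg_of_neg (by linarith) (mul_neg_of_pos_of_neg hk0 (by linarith))
  · have hψ := mul_curvatureLogRatio_pos hk0 hk2 hk1 hm hkm hr hA
    have hlog : curvatureLogRatio k m r =
        Real.log (r ^ (k - 2) * ((k + 1) * r + (k - 1) * (m + 1))) -
          Real.log ((r + m) ^ (k - 2) * ((k + 1) * r + (2 * m - k + 1))) := by
      rw [Real.log_mul hR.ne' hA.ne', Real.log_mul hU.ne' hB.ne', Real.log_rpow hr0,
        Real.log_rpow hrm, curvatureLogRatio]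
      ring
    rw [hlog] at hψ
    rcases lt_or_gt_of_ne hk1 with hk | hk
    · have h := (Real.log_lt_log_iff (mul_pos hR hA) (mul_pos hU hB)).mp
        (by nlinarith : Real.log _ < Real.log _)
      exact mul_pos_of_neg_of_neg (by linarith) (mul_neg_of_pos_of_neg hk0 (by linarith))
    · have h := (Real.log_lt_log_iff (mul_pos hU hB) (mul_pos hR hA)).mp
        (by nlinarith : Real.log _ < Real.log _)
      exact mul_pos (by linarith) (mul_pos hk0 (by linarith))

lemma strictConvexOn_mul_collinearityDefect {k m : ℝ} (hk0 : 0 < k) (hk2 : k < 2) (hk1 : k ≠ 1)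
    (hm : 2 ≤ m) (hkm : (k - 1) * m ≤ 2) :
    StrictConvexOn ℝ (Set.Ici 1) fun r => (k - 1) * collinearityDefect k m r := by
  refine strictConvexOn_of_deriv2_pos (convex_Ici 1) (fun r hr => ?_) fun r hr => ?_
  · have : (0 : ℝ) < r := lt_of_lt_of_le one_pos hr
    exact ((hasDerivAt_collinearityDefect k (by linarith) this).const_mul
      (k - 1)).continuousAt.continuousWithinAt
  · rw [interior_Ici] at hr
    have hr' : (1 : ℝ) ≤ r := le_of_lt hr
    have h := mul_deriv2_collinearityDefect_pos hk0 hk2 hk1 hm hkm hr'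
    simp only [Function.iterate_succ, Function.iterate_zero, Function.comp, id] at h ⊢
    simpa using h

/-- A strictly convex function on `[1, ∞)` vanishing at `1` and nonnegative at `r > 1` is positive
beyond `r`. -/
lemma pos_of_strictConvexOn {f : ℝ → ℝ} (hf : StrictConvexOn ℝ (Set.Ici 1) f) (h1 : f 1 = 0)
    {r s : ℝ} (hr : 1 < r) (hfr : 0 ≤ f r) (hs : r < s) : 0 < f s := by
  have h := hf.slope_strict_mono_adjacent Set.self_mem_Ici
    (Set.mem_Ici.mpr (by linarith : (1 : ℝ) ≤ s)) hr hs
  rw [h1] at h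
  have h2 : 0 ≤ (f r - 0) / (r - 1) := div_nonneg (by linarith) (by linarith)
  have h3 := (div_pos_iff_of_pos_right (by linarith : 0 < s - r)).mp (h2.trans_lt h)
  linarith

lemma collinearityDefect_neg_of_eq {k m r : ℝ} (hm : 2 ≤ m) (hkm : (k - 1) * m = 2) (hr : 1 < r) :
    collinearityDefect k m r < 0 := by
  -- At `m = 2` the exponent is `k = 2`, outside the convexity lemma; there the defect is just `2 -
  -- 2 r`.
  rcases eq_or_lt_of_le hm with rfl | hm2
  · obtain rfl : k = 2 := by linarith
    simp only [collinearityDefect, Real.rpow_two]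
    nlinarith
  have hk1 : 1 < k := by
    by_contra h
    push Not at h
    nlinarith
  have hk2 : k < 2 := by
    by_contra h
    push Not at h
    nlinarith
  -- A nonnegative value at `r` would persist, by convexity, as positivity at all larger `s`.
  -- Bernoulli bounds the defect at `s` by `((m + 2) s ^ (k - 2) - 2) s - m`, which is negative for
  -- large `s`.
  by_contra! hE
  have hconv := strictConvexOn_mul_collinearityDefect (by linarith) hk2 hk1.ne' hm hkm.le
  have hlim : Filter.Tendsto (fun s : ℝ => s ^ (-(2 - k))) Filter.atTop (nhds 0) :=
    tendsto_rpow_neg_atTop (by linarith)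
  have hsmall := (hlim.const_mul (m + 2)).eventually_lt_const (by norm_num : (m + 2) * 0 < (2 : ℝ))
  obtain ⟨s, hs1, hs2⟩ := (hsmall.and (Filter.eventually_gt_atTop r)).exists
  have hs0 : 0 < s := by linarith
  have hpos := pos_of_strictConvexOn hconv (by simp [collinearityDefect_one]) hr
    (mul_nonneg (by linarith) hE) hs2
  have hpos' := (mul_pos_iff_of_pos_left (by linarith : 0 < k - 1)).mp hpos
  have hbern : 1 + k * (m / s) ≤ (1 + m / s) ^ k :=
    one_add_mul_self_le_rpow_one_add (by have : 0 < m / s := by positivity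
                                         linarith) hk1.le
  have hfac : (s + m) ^ k = s ^ k * (1 + m / s) ^ k := by
    rw [← Real.mul_rpow hs0.le (by positivity)]
    congr 1
    field_simp
  have hsk : s ^ k = s ^ (-(2 - k)) * s ^ 2 := by
    rw [← Real.rpow_natCast, ← Real.rpow_add hs0]
    congr 1
    push_cast
    ring
  have hkm' : k * m = m + 2 := by linarith
  have h1 : (s - 1) * (s ^ k * (1 + k * (m / s))) ≤ (s - 1) * (s + m) ^ k := by
    rw [hfac]
    exact mul_le_mul_of_nonneg_left (mul_le_mul_of_nonneg_left hbern (by positivity)) (by linarith)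
  have h2 : (s - 1) * (s ^ k * (1 + k * (m / s))) =
      (s + m + 1) * s ^ k - (m + 2) * s ^ (-(2 - k)) * s := by
    have : s ^ k * (1 + k * (m / s)) = s ^ (-(2 - k)) * (s ^ 2 + (m + 2) * s) := by
      rw [hsk, ← hkm']
      field_simp
    rw [this, hsk]
    ring
  simp only [collinearityDefect] at hpos'
  nlinarith

/-- With `r` fixed, `-collinearityDefect j m r / r ^ j` is convex in the exponent `j`, being a sum
of exponentials and a constant. It vanishes at `j = 1` and is positive at the critical exponent `l =
1 + 2 / m`, hence positive at every `k ≥ l`. -/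
lemma collinearityDefect_neg {k m r : ℝ} (hm : 2 ≤ m) (hkm : 2 ≤ (k - 1) * m) (hr : 1 < r) :
    collinearityDefect k m r < 0 := by
  have hr0 : 0 < r := by linarith
  have hm0 : 0 < m := by linarith
  set l : ℝ := 1 + 2 / m with hl
  have hlm : (l - 1) * m = 2 := by rw [hl]; field_simp; ring
  have hEl := collinearityDefect_neg_of_eq hm hlm hr
  have hl1 : 1 < l := by
    have : 0 < 2 / m := by positivity
    linarith
  have hlk : l ≤ k := by
    have : 2 / m ≤ k - 1 := by rwa [div_le_iff₀ hm0]
    linarith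
  rcases eq_or_lt_of_le hlk with h | hlk
  · rwa [← h]
  have hexp : ∀ c : ℝ, 0 < c → ConvexOn ℝ Set.univ fun j : ℝ => c ^ j := fun c hc => by
    have := (convexOn_exp.comp_linearMap (LinearMap.mul ℝ ℝ (Real.log c)))
    refine this.congr fun j _ => ?_
    simp [Real.rpow_def_of_pos hc]
  have hconv : ConvexOn ℝ Set.univ fun j : ℝ =>
      (r - 1) * ((r + m) / r) ^ j + (2 * r + m) * (r⁻¹) ^ j + -(r + m + 1) :=
    (((hexp _ (by positivity)).smul (by linarith)).add
      ((hexp _ (by positivity)).smul (by linarith))).add_const _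
  have hval : ∀ j : ℝ, (r - 1) * ((r + m) / r) ^ j + (2 * r + m) * (r⁻¹) ^ j + -(r + m + 1) =
      -(collinearityDefect j m r / r ^ j) := fun j => by
    have := (Real.rpow_pos_of_pos hr0 j).ne'
    rw [Real.div_rpow (by positivity) hr0.le, Real.inv_rpow hr0.le, collinearityDefect]
    field_simp
    ring
  have hslope := hconv.slope_mono_adjacent (Set.mem_univ 1) (Set.mem_univ k) hl1 hlk
  simp only [hval] at hslope
  have hone : collinearityDefect 1 m r = 0 := by
    simp only [collinearityDefect, Real.rpow_one]; ring
  rw [hone] at hslope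
  have hpos : 0 < -(collinearityDefect l m r / r ^ l) := by
    have := div_neg_of_neg_of_pos hEl (Real.rpow_pos_of_pos hr0 l)
    linarith
  have h1 : 0 < (-(collinearityDefect l m r / r ^ l) - -(0 / r ^ (1 : ℝ))) / (l - 1) := by
    rw [zero_div, neg_zero, sub_zero]
    exact div_pos hpos (by linarith)
  have h2 := (div_pos_iff_of_pos_right (by linarith : 0 < k - l)).mp (h1.trans_le hslope)
  have h3 : collinearityDefect k m r / r ^ k < 0 := by linarith
  by_contra! h
  exact absurd (div_nonneg h (Real.rpow_pos_of_pos hr0 k).le) (not_le.mpr h3)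

/-! ### Monotonicity along the one-parameter family -/

/-- The `q`-th power sum of `(r + m, -r, -1, …, -1)` with `m` entries `-1`. -/
noncomputable def familyPowerSum (q m r : ℝ) : ℝ := (r + m) ^ q + r ^ q + m

/-- The sum of the squares of `(r + m, -r, -1, …, -1)` with `m` entries `-1`. -/
noncomputable def familySqSum (m r : ℝ) : ℝ := (r + m) ^ 2 + r ^ 2 + m

/-- At an interior critical point of the family `(r + m, -r, -1, …, -1)`, the normalized power sum
is strictly improved by increasing `r`. -/
lemma exists_better_of_collinearityDefect_eq_zero {k m r : ℝ} (hk0 : 0 < k) (hk1 : k ≠ 1)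
    (hm : 2 ≤ m) (hr : 1 < r) (hE : collinearityDefect k m r = 0) :
    (k - 1) * (familyPowerSum (k + 1) m r * familySqSum m (r + 1) ^ ((k + 1) / 2)) <
      (k - 1) * (familyPowerSum (k + 1) m (r + 1) * familySqSum m r ^ ((k + 1) / 2)) := by
  have hkm : (k - 1) * m < 2 := by
    by_contra! h
    exact absurd hE (collinearityDefect_neg hm h hr).ne
  have hk2 : k < 2 := by
    by_contra! h
    nlinarith
  have hconv := strictConvexOn_mul_collinearityDefect hk0 hk2 hk1 hm hkm.le
  have hN : ∀ s ∈ Set.Ici r, 0 < familyPowerSum (k + 1) m s := fun s hs => by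
    have : r ≤ s := hs
    have : 0 < s := by linarith
    have : 0 < m := by linarith
    unfold familyPowerSum
    positivity
  have hD : ∀ s ∈ Set.Ici r, 0 < familySqSum m s := fun s hs => by
    have : r ≤ s := hs
    have : 0 < s := by linarith
    have : 0 < m := by linarith
    unfold familySqSum
    positivity
  -- The logarithmic derivative of the normalized power sum is a positive multiple of the
  -- collinearity defect.
  have hder : ∀ s ∈ Set.Ici r, HasDerivAt (fun s => (k - 1) * (Real.log (familyPowerSum (k + 1) m s)
      - (k + 1) / 2 * Real.log (familySqSum m s)))
      ((k + 1) * m * ((k - 1) * collinearityDefect k m s) /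
        (familyPowerSum (k + 1) m s * familySqSum m s)) s := by
    intro s hs
    have hrs : r ≤ s := hs
    have hs0 : 0 < s := by linarith
    have hsm : 0 < s + m := by linarith
    have h1 : HasDerivAt (familyPowerSum (k + 1) m)
        (1 * (k + 1) * (s + m) ^ (k + 1 - 1) + (k + 1) * s ^ (k + 1 - 1)) s :=
      ((((hasDerivAt_id' s).add_const m).rpow_const (Or.inl hsm.ne')).add
        (Real.hasDerivAt_rpow_const (Or.inl hs0.ne'))).add_const m
    have h2 : HasDerivAt (familySqSum m) (2 * (s + m) + 2 * s) s := by
      refine (((((hasDerivAt_id' s).add_const m).pow 2).add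
        ((hasDerivAt_id' s).pow 2)).add_const m).congr_deriv ?_
      simp
    have h := ((h1.log (hN s hs).ne').sub
      ((h2.log (hD s hs).ne').const_mul ((k + 1) / 2))).const_mul (k - 1)
    refine h.congr_deriv ?_
    have hN' := (hN s hs).ne'
    have hD' := (hD s hs).ne'
    rw [add_sub_cancel_right]
    field_simp
    simp only [familyPowerSum, familySqSum, collinearityDefect, Real.rpow_add_one hsm.ne',
      Real.rpow_add_one hs0.ne']
    ring
  have hmono : StrictMonoOn (fun s => (k - 1) * (Real.log (familyPowerSum (k + 1) m s)
      - (k + 1) / 2 * Real.log (familySqSum m s))) (Set.Ici r) := by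
    refine strictMonoOn_of_deriv_pos (convex_Ici r)
      (fun s hs => (hder s hs).continuousAt.continuousWithinAt) fun s hs => ?_
    rw [interior_Ici] at hs
    have hs' : s ∈ Set.Ici r := Set.Ioi_subset_Ici_self hs
    rw [(hder s hs').deriv]
    have hpos := pos_of_strictConvexOn hconv (by simp [collinearityDefect_one]) hr
      (by simp [hE]) hs
    have : 0 < m := by linarith
    exact div_pos (mul_pos (by positivity) hpos) (mul_pos (hN s hs') (hD s hs'))
  have hr1 : r + 1 ∈ Set.Ici r := by simp
  have hlt := hmono Set.self_mem_Ici hr1 (by linarith)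
  simp only at hlt
  have hN0 := hN r Set.self_mem_Ici
  have hN1 := hN (r + 1) hr1
  have hD0 := Real.rpow_pos_of_pos (hD r Set.self_mem_Ici) ((k + 1) / 2)
  have hD1 := Real.rpow_pos_of_pos (hD (r + 1) hr1) ((k + 1) / 2)
  rw [← Real.log_rpow (hD r Set.self_mem_Ici), ← Real.log_rpow (hD (r + 1) hr1)] at hlt
  rcases lt_or_gt_of_ne hk1 with hk | hk
  · refine mul_lt_mul_of_neg_left ?_ (by linarith)
    rw [← Real.log_lt_log_iff (by positivity) (by positivity), Real.log_mul hN1.ne' hD0.ne',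
      Real.log_mul hN0.ne' hD1.ne']
    have := (mul_lt_mul_left_of_neg (by linarith : k - 1 < 0)).mp hlt
    linarith
  · refine mul_lt_mul_of_pos_left ?_ (by linarith)
    rw [← Real.log_lt_log_iff (by positivity) (by positivity), Real.log_mul hN1.ne' hD0.ne',
      Real.log_mul hN0.ne' hD1.ne']
    have := (mul_lt_mul_iff_of_pos_left (by linarith : 0 < k - 1)).mp hlt
    linarith

/-! ### Extremal vectors and their first and second variations -/

/-- The sum `∑ i, |x i| ^ q`. -/
noncomputable def powerSum {d : ℕ} (q : ℝ) (x : Fin d → ℝ) : ℝ := ∑ i, |x i| ^ q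

/-- The sum of the squares of the coordinates. -/
noncomputable def sqSum {d : ℕ} (x : Fin d → ℝ) : ℝ := ∑ i, x i ^ 2

/-- `x` maximizes (`2 < q`) or minimizes (`q < 2`) the quotient `‖x‖_q / ‖x‖_2` among the nonzero
vectors with zero coordinate sum; the condition is stated without quotients. -/
def IsExtremal {d : ℕ} (q : ℝ) (x : Fin d → ℝ) : Prop :=
  x ∈ admissible d ∧ ∀ y : Fin d → ℝ, ∑ i, y i = 0 →
    0 ≤ (q - 2) * (powerSum q x * sqSum y ^ (q / 2) - powerSum q y * sqSum x ^ (q / 2))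

variable {d : ℕ}

lemma sqSum_nonneg (x : Fin d → ℝ) : 0 ≤ sqSum x := sum_nonneg fun _ _ => sq_nonneg _

lemma sqSum_pos {x : Fin d → ℝ} (hx : x ≠ 0) : 0 < sqSum x := by
  obtain ⟨i, hi⟩ := Function.ne_iff.mp hx
  exact sum_pos' (fun _ _ => sq_nonneg _) ⟨i, mem_univ i, by simpa using sq_pos_of_ne_zero hi⟩

lemma powerSum_pos {x : Fin d → ℝ} (q : ℝ) (hx : x ≠ 0) : 0 < powerSum q x := by
  obtain ⟨i, hi⟩ := Function.ne_iff.mp hx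
  exact sum_pos' (fun _ _ => Real.rpow_nonneg (abs_nonneg _) _)
    ⟨i, mem_univ i, Real.rpow_pos_of_pos (abs_pos.mpr hi) _⟩

lemma powerSum_smul (q c : ℝ) (x : Fin d → ℝ) :
    powerSum q (fun i => c * x i) = |c| ^ q * powerSum q x := by
  simp only [powerSum, abs_mul, mul_sum]
  exact sum_congr rfl fun i _ => Real.mul_rpow (abs_nonneg _) (abs_nonneg _)

lemma sqSum_smul (c : ℝ) (x : Fin d → ℝ) : sqSum (fun i => c * x i) = c ^ 2 * sqSum x := by
  simp only [sqSum, mul_pow, mul_sum]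

lemma sqSum_smul_rpow (q c : ℝ) (x : Fin d → ℝ) :
    sqSum (fun i => c * x i) ^ (q / 2) = |c| ^ q * sqSum x ^ (q / 2) := by
  rw [sqSum_smul, Real.mul_rpow (sq_nonneg _) (sqSum_nonneg _), ← sq_abs, ← Real.rpow_natCast,
    ← Real.rpow_mul (abs_nonneg _)]
  congr 2
  push_cast
  ring

lemma IsExtremal.neg {q : ℝ} {x : Fin d → ℝ} (hx : IsExtremal q x) : IsExtremal q (-x) := by
  refine ⟨⟨neg_ne_zero.mpr hx.1.1, by simp [hx.1.2]⟩, fun y hy => ?_⟩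
  have h1 : powerSum q (-x) = powerSum q x := by simp [powerSum]
  have h2 : sqSum (-x) = sqSum x := by simp [sqSum]
  rw [h1, h2]
  exact hx.2 y hy

/-- `x + t (e_i - e_j)`. -/
def transfer (x : Fin d → ℝ) (i j : Fin d) (t : ℝ) : Fin d → ℝ := fun l =>
  x l + (if l = i then t else if l = j then -t else 0)

lemma sum_comp_transfer (φ : ℝ → ℝ) (x : Fin d → ℝ) {i j : Fin d} (hij : i ≠ j) (t : ℝ) :
    ∑ l, φ (transfer x i j t l) =
      ∑ l, φ (x l) + ((φ (x i + t) - φ (x i)) + (φ (x j - t) - φ (x j))) := by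
  rw [← sub_eq_iff_eq_add', ← sum_sub_distrib, Fintype.sum_eq_add i j hij]
  · simp [transfer, hij.symm, sub_eq_add_neg]
  · rintro l ⟨hi, hj⟩
    simp [transfer, hi, hj]

lemma sum_transfer (x : Fin d → ℝ) {i j : Fin d} (hij : i ≠ j) (t : ℝ) :
    ∑ l, transfer x i j t l = ∑ l, x l := by
  have := sum_comp_transfer id x hij t
  simpa using this

lemma sqSum_transfer (x : Fin d → ℝ) {i j : Fin d} (hij : i ≠ j) (t : ℝ) :
    sqSum (transfer x i j t) =
      sqSum x + (((x i + t) ^ 2 - x i ^ 2) + ((x j - t) ^ 2 - x j ^ 2)) :=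
  sum_comp_transfer (fun s => s ^ 2) x hij t

lemma powerSum_transfer (q : ℝ) (x : Fin d → ℝ) {i j : Fin d} (hij : i ≠ j) (t : ℝ) :
    powerSum q (transfer x i j t) =
      powerSum q x + ((|x i + t| ^ q - |x i| ^ q) + (|x j - t| ^ q - |x j| ^ q)) :=
  sum_comp_transfer (fun s => |s| ^ q) x hij t

/-- The first-order condition for extremal vectors. -/
lemma IsExtremal.lagrange {q : ℝ} {x : Fin d → ℝ} (hq1 : 1 < q) (hq2 : q ≠ 2)
    (hx : IsExtremal q x) (i j : Fin d) :
    |x i| ^ (q - 2) * x i - |x j| ^ (q - 2) * x j =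
      powerSum q x / sqSum x * (x i - x j) := by
  rcases eq_or_ne i j with rfl | hij
  · simp
  have hD := sqSum_pos hx.1.1
  set F := powerSum q x with hF
  set D := sqSum x with hDdef
  -- The extremality inequality along `x + t (e_i - e_j)`, which keeps the sum zero; it has a
  -- minimum, equal to `0`, at `t = 0`.
  let G : ℝ → ℝ := fun t => (q - 2) * (F * (D + (((x i + t) ^ 2 - x i ^ 2) +
    ((x j - t) ^ 2 - x j ^ 2))) ^ (q / 2) -
    (F + ((|x i + t| ^ q - |x i| ^ q) + (|x j - t| ^ q - |x j| ^ q))) * D ^ (q / 2))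
  have hG : ∀ t, 0 ≤ G t := fun t => by
    have h := hx.2 (transfer x i j t) (by rw [sum_transfer x hij, hx.1.2])
    rw [sqSum_transfer x hij, powerSum_transfer q x hij] at h
    exact h
  have hG0 : G 0 = 0 := by simp [G]
  have hmin : IsLocalMin G 0 := Filter.Eventually.of_forall fun t => by rw [hG0]; exact hG t
  have hadd : HasDerivAt (fun t : ℝ => x i + t) 1 0 := (hasDerivAt_id' 0).const_add _
  have hsub : HasDerivAt (fun t : ℝ => x j - t) (-1) 0 := (hasDerivAt_id' 0).const_sub _
  have habs : ∀ (u v : ℝ) (f : ℝ → ℝ), HasDerivAt f v 0 → f 0 = u →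
      HasDerivAt (fun t => |f t| ^ q) (q * |u| ^ (q - 2) * u * v) 0 := by
    intro u v f hf hu
    have := hasDerivAt_abs_rpow (f 0) hq1
    rw [hu] at this
    exact HasDerivAt.comp_of_eq (h₂ := fun s => |s| ^ q) 0 this hf hu.symm
  have h1 := habs (x i) 1 _ hadd (by simp)
  have h2 := habs (x j) (-1) _ hsub (by simp)
  have h3 : HasDerivAt (fun t : ℝ => D + (((x i + t) ^ 2 - x i ^ 2) +
      ((x j - t) ^ 2 - x j ^ 2))) (2 * (x i - x j)) 0 := by
    refine ((((hadd.pow 2).sub_const _).add ((hsub.pow 2).sub_const _)).const_add D).congr_deriv ?_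
    simp
    ring
  have h4 := h3.rpow_const (p := q / 2) (Or.inl (by simpa using hD.ne'))
  have h5 := ((h4.const_mul F).sub ((((h1.sub_const (|x i| ^ q)).add
    (h2.sub_const (|x j| ^ q))).const_add F).mul_const (D ^ (q / 2)))).const_mul (q - 2)
  have h6 := hmin.hasDerivAt_eq_zero h5
  have hDq : D ^ (q / 2) = D ^ (q / 2 - 1) * D := by
    rw [← Real.rpow_add_one hD.ne']
    ring_nf
  have hD1 := (Real.rpow_pos_of_pos hD (q / 2 - 1)).ne'
  simp only [add_zero, sub_zero, sub_self, hDq] at h6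
  have hq2' : q - 2 ≠ 0 := sub_ne_zero.mpr hq2
  have hq0 : q ≠ 0 := by linarith
  have h7 : (q - 2) * q * D ^ (q / 2 - 1) * (F * (x i - x j) -
      D * (|x i| ^ (q - 2) * x i - |x j| ^ (q - 2) * x j)) = 0 := by
    rw [← h6]; ring
  have h8 := (mul_eq_zero.mp h7).resolve_left (by simp [hq2', hq0, hD1])
  field_simp
  linarith

/-- The second-order necessary condition at a minimum with known first derivative. -/
lemma second_deriv_nonneg_of_isLocalMin {G G' : ℝ → ℝ} {c : ℝ}
    (hmin : IsLocalMin G 0) (hG : ∀ᶠ t in nhds 0, HasDerivAt G (G' t) t)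
    (hG' : HasDerivAt G' c 0) : 0 ≤ c := by
  by_contra! hc
  have hev : deriv G =ᶠ[nhds 0] G' := hG.mono fun t ht => ht.deriv
  have hdd : deriv (deriv G) 0 = c := by rw [hev.deriv_eq, hG'.deriv]
  -- A negative second derivative would make `0` a local maximum as well, so `G` would be locally
  -- constant and its second derivative zero.
  have hmax := isLocalMax_of_deriv_deriv_neg (by rwa [hdd]) hmin.deriv_eq_zero
    hG.self_of_nhds.continuousAt
  have hconst : G =ᶠ[nhds 0] fun _ => G 0 := by
    filter_upwards [hmin, hmax] with t h1 h2
    exact le_antisymm h2 h1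
  have h0 : deriv (deriv G) 0 = 0 := by
    have h1 := hconst.deriv
    rw [h1.deriv_eq]
    simp
  linarith

/-- For `-1 < j < 0` differentiability fails at `0`; hence the second-order condition is stated only
at nonzero coordinates. -/
lemma hasDerivAt_abs_rpow_mul_self (j : ℝ) {u : ℝ} (hu : u ≠ 0) :
    HasDerivAt (fun s : ℝ => |s| ^ j * s) ((j + 1) * |u| ^ j) u := by
  have h := ((hasDerivAt_abs hu).rpow_const (p := j) (Or.inl (abs_ne_zero.mpr hu))).mul
    (hasDerivAt_id' u)
  refine h.congr_deriv ?_
  have h1 : |u| ^ j = |u| ^ (j - 1) * |u| := by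
    rw [← Real.rpow_add_one (abs_ne_zero.mpr hu), sub_add_cancel]
  have h2 : ((SignType.sign u : SignType) : ℝ) * u = |u| := sign_mul_self u
  rw [h1]
  linear_combination (j * |u| ^ (j - 1)) * h2

/-- The second-order condition for extremal vectors at a repeated coordinate. -/
lemma IsExtremal.second_order {q : ℝ} {x : Fin d → ℝ} (hq1 : 1 < q)
    (hx : IsExtremal q x) {i j : Fin d} (hij : i ≠ j) (hxij : x i = x j) (hxi : x i ≠ 0) :
    0 ≤ (q - 2) * (powerSum q x / sqSum x - (q - 1) * |x i| ^ (q - 2)) := by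
  have hD := sqSum_pos hx.1.1
  set F := powerSum q x with hF
  set D := sqSum x with hDdef
  set u := x i with hu
  let G : ℝ → ℝ := fun t => (q - 2) * (F * (D + (((u + t) ^ 2 - u ^ 2) +
    ((u - t) ^ 2 - u ^ 2))) ^ (q / 2) -
    (F + ((|u + t| ^ q - |u| ^ q) + (|u - t| ^ q - |u| ^ q))) * D ^ (q / 2))
  have hG : ∀ t, 0 ≤ G t := fun t => by
    have h := hx.2 (transfer x i j t) (by rw [sum_transfer x hij, hx.1.2])
    rw [sqSum_transfer x hij, powerSum_transfer q x hij] at h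
    simp only [← hxij] at h
    exact h
  have hG0 : G 0 = 0 := by simp [G]
  have hmin : IsLocalMin G 0 := Filter.Eventually.of_forall fun t => by rw [hG0]; exact hG t
  have hadd : ∀ s, HasDerivAt (fun t : ℝ => u + t) 1 s := fun s => (hasDerivAt_id' s).const_add _
  have hsub : ∀ s, HasDerivAt (fun t : ℝ => u - t) (-1) s := fun s => (hasDerivAt_id' s).const_sub _
  have hbase : ∀ t : ℝ, 0 < D + (((u + t) ^ 2 - u ^ 2) + ((u - t) ^ 2 - u ^ 2)) := fun t => by
    nlinarith [sq_nonneg t]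
  have h3 : ∀ s, HasDerivAt (fun t : ℝ => D + (((u + t) ^ 2 - u ^ 2) +
      ((u - t) ^ 2 - u ^ 2))) (4 * s) s := fun s => by
    refine (((((hadd s).pow 2).sub_const _).add
      (((hsub s).pow 2).sub_const _)).const_add D).congr_deriv ?_
    simp
    ring
  have habs : ∀ s, HasDerivAt (fun t => |u + t| ^ q) (q * (|u + s| ^ (q - 2) * (u + s))) s :=
    fun s => ((hasDerivAt_abs_rpow (u + s) hq1).comp s (hadd s)).congr_deriv (by ring)
  have habs' : ∀ s, HasDerivAt (fun t => |u - t| ^ q) (-(q * (|u - s| ^ (q - 2) * (u - s)))) s :=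
    fun s => ((hasDerivAt_abs_rpow (u - s) hq1).comp s (hsub s)).congr_deriv (by ring)
  have hder : ∀ s, HasDerivAt G ((q - 2) * (F * (4 * s * (q / 2) *
      (D + (((u + s) ^ 2 - u ^ 2) + ((u - s) ^ 2 - u ^ 2))) ^ (q / 2 - 1)) -
      (q * (|u + s| ^ (q - 2) * (u + s)) + -(q * (|u - s| ^ (q - 2) * (u - s)))) *
        D ^ (q / 2))) s := fun s =>
    ((((h3 s).rpow_const (p := q / 2) (Or.inl (hbase s).ne')).const_mul F).sub
      (((((habs s).sub_const _).add ((habs' s).sub_const _)).const_add F).mul_const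
        (D ^ (q / 2)))).const_mul (q - 2)
  have k1 : HasDerivAt (fun s => |u + s| ^ (q - 2) * (u + s)) ((q - 1) * |u| ^ (q - 2)) 0 := by
    have h := hasDerivAt_abs_rpow_mul_self (q - 2) hxi
    exact (HasDerivAt.comp_of_eq (h₂ := fun s => |s| ^ (q - 2) * s) 0 h (hadd 0)
      (by simp)).congr_deriv (by ring)
  have k2 : HasDerivAt (fun s => |u - s| ^ (q - 2) * (u - s)) (-((q - 1) * |u| ^ (q - 2))) 0 := by
    have h := hasDerivAt_abs_rpow_mul_self (q - 2) hxi
    exact (HasDerivAt.comp_of_eq (h₂ := fun s => |s| ^ (q - 2) * s) 0 h (hsub 0)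
      (by simp)).congr_deriv (by ring)
  have k3 := (h3 0).rpow_const (p := q / 2 - 1) (Or.inl (hbase 0).ne')
  have k4 := ((((((hasDerivAt_id' (0 : ℝ)).const_mul 4).mul_const (q / 2)).mul k3).const_mul F).sub
    (((k1.const_mul q).add (k2.const_mul q).neg).mul_const (D ^ (q / 2)))).const_mul (q - 2)
  have h := second_deriv_nonneg_of_isLocalMin hmin (Filter.Eventually.of_forall hder) k4
  have hDq : D ^ (q / 2) = D ^ (q / 2 - 1) * D := by
    rw [← Real.rpow_add_one hD.ne']
    ring_nf
  simp only [add_zero, sub_zero, sub_self, hDq] at h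
  have hD1 := Real.rpow_pos_of_pos hD (q / 2 - 1)
  have h7 : 0 ≤ (2 * q * D ^ (q / 2 - 1) * D) *
      ((q - 2) * (F / D - (q - 1) * |u| ^ (q - 2))) := by
    convert h using 1
    field_simp
    ring
  exact nonneg_of_mul_nonneg_right h7 (by positivity)

/-! ### Edge, vertex and family vectors -/

lemma exists_perm_two (hd : 2 ≤ d) {i j : Fin d} (hij : i ≠ j) :
    ∃ σ : Equiv.Perm (Fin d), ((σ i : Fin d) : ℕ) = 0 ∧ ((σ j : Fin d) : ℕ) = 1 := by
  let z : Fin d := ⟨0, by omega⟩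
  let o : Fin d := ⟨1, by omega⟩
  have hzo : z ≠ o := by simp [z, o]
  refine ⟨(Equiv.swap i z).trans (Equiv.swap (Equiv.swap i z j) o), ?_, ?_⟩
  · have h1 : z ≠ Equiv.swap i z j := fun h => hij (by
      have := congrArg (Equiv.swap i z) h
      simpa using this)
    simp [Equiv.swap_apply_of_ne_of_ne h1 hzo, z]
  · simp [o]

lemma equivalent_edgeVector (hd : 2 ≤ d) {x : Fin d → ℝ} {i j : Fin d} (hij : i ≠ j)
    (hi : x i ≠ 0) (hj : x j = -x i) (h : ∀ l, l ≠ i → l ≠ j → x l = 0) :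
    Equivalent x (edgeVector d) := by
  obtain ⟨σ, h0, h1⟩ := exists_perm_two hd hij
  refine ⟨x i, hi, σ, fun l => ?_⟩
  rcases eq_or_ne l i with rfl | hli
  · simp [edgeVector, h0]
  rcases eq_or_ne l j with rfl | hlj
  · simp [edgeVector, h1, hj]
  have n0 : ((σ l : Fin d) : ℕ) ≠ 0 := fun hl => hli (σ.injective (Fin.ext (hl.trans h0.symm)))
  have n1 : ((σ l : Fin d) : ℕ) ≠ 1 := fun hl => hlj (σ.injective (Fin.ext (hl.trans h1.symm)))
  simp [edgeVector, n0, n1, h l hli hlj]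

lemma equivalent_vertexVector {x : Fin d → ℝ} {i : Fin d} {s : ℝ}
    (hs : s ≠ 0) (hi : x i = s * (d - 1)) (h : ∀ l, l ≠ i → x l = -s) :
    Equivalent x (vertexVector d) := by
  let z : Fin d := ⟨0, i.pos⟩
  refine ⟨s, hs, Equiv.swap i z, fun l => ?_⟩
  rcases eq_or_ne l i with rfl | hli
  · simp [vertexVector, hi, z]
  have n0 : ((Equiv.swap i z l : Fin d) : ℕ) ≠ 0 := fun hl => hli (by
    have h2 : Equiv.swap i z l = Equiv.swap i z i := by
      rw [Equiv.swap_apply_left]; exact Fin.ext hl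
    exact (Equiv.swap i z).injective h2)
  simp [vertexVector, n0, h l hli]

lemma sum_ite_ite {i j : Fin d} (hij : i ≠ j) (A B C : ℝ) :
    ∑ l, (if l = i then A else if l = j then B else C) = A + B + ((d : ℝ) - 2) * C := by
  have : ∀ l, (if l = i then A else if l = j then B else C) =
      C + ((if l = i then A - C else 0) + (if l = j then B - C else 0)) := fun l => by
    rcases eq_or_ne l i with rfl | hi
    · simp [hij]
    · simp [hi]; split_ifs <;> ring
  simp only [this, sum_add_distrib, sum_ite_eq', mem_univ, if_true, sum_const, card_univ,
    Fintype.card_fin, nsmul_eq_mul]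
  ring

/-- The vector `(r + d - 2, -r, -1, …, -1)`, with its first two entries at `i` and `j`. -/
def familyVector (i j : Fin d) (r : ℝ) : Fin d → ℝ := fun l =>
  if l = i then r + ((d : ℝ) - 2) else if l = j then -r else -1

lemma sum_comp_familyVector (φ : ℝ → ℝ) {i j : Fin d} (hij : i ≠ j) (r : ℝ) :
    ∑ l, φ (familyVector i j r l) = φ (r + ((d : ℝ) - 2)) + φ (-r) + ((d : ℝ) - 2) * φ (-1) := by
  rw [← sum_ite_ite hij]
  refine sum_congr rfl fun l _ => ?_
  simp only [familyVector]
  split_ifs <;> rfl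

lemma sum_familyVector {i j : Fin d} (hij : i ≠ j) (r : ℝ) : ∑ l, familyVector i j r l = 0 := by
  have := sum_comp_familyVector id hij r
  simp only [id] at this
  rw [this]
  ring

lemma powerSum_familyVector (hd : 2 ≤ d) (q : ℝ) {i j : Fin d} (hij : i ≠ j) {r : ℝ} (hr : 0 < r) :
    powerSum q (familyVector i j r) = familyPowerSum q ((d : ℝ) - 2) r := by
  have hd' : (2 : ℝ) ≤ d := by exact_mod_cast hd
  rw [powerSum, sum_comp_familyVector (fun s => |s| ^ q) hij, familyPowerSum]
  simp [abs_of_pos hr, abs_of_pos (by linarith : 0 < r + ((d : ℝ) - 2))]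

lemma sqSum_familyVector {i j : Fin d} (hij : i ≠ j) (r : ℝ) :
    sqSum (familyVector i j r) = familySqSum ((d : ℝ) - 2) r := by
  rw [sqSum, sum_comp_familyVector (fun s => s ^ 2) hij, familySqSum]
  simp

/-! ### Intersections of an odd power with a line -/

/-- The odd power function `t ↦ t ^ (k - 1) * t` lies strictly above (`1 < k`) or below (`k < 1`)
its tangents. -/
lemma tangent_lt {k s t : ℝ} (hk0 : 0 < k) (hk1 : k ≠ 1) (hs : 0 < s) (ht : 0 < t) (hst : s ≠ t) :
    0 < (k - 1) * (t ^ (k - 1) * t - s ^ (k - 1) * s - k * s ^ (k - 1) * (t - s)) := by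
  -- Scaling by `s` turns the tangent inequality into the strict Bernoulli inequality at `t / s -
  -- 1`.
  have hfac : t ^ (k - 1) * t = s ^ (k - 1) * s * (1 + (t / s - 1)) ^ k := by
    rw [← Real.rpow_add_one ht.ne', ← Real.rpow_add_one hs.ne', sub_add_cancel,
      ← Real.mul_rpow hs.le (by rw [add_sub_cancel]; positivity)]
    congr 1
    field_simp
    ring
  have hne : t / s - 1 ≠ 0 := by
    rw [sub_ne_zero, Ne, div_eq_one_iff_eq hs.ne']
    exact hst.symm
  have hge : -1 ≤ t / s - 1 := by
    have : 0 < t / s := by positivity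
    linarith
  have hpos : 0 < s ^ (k - 1) * s := by positivity
  have heq : t ^ (k - 1) * t - s ^ (k - 1) * s - k * s ^ (k - 1) * (t - s) =
      s ^ (k - 1) * s * ((1 + (t / s - 1)) ^ k - (1 + k * (t / s - 1))) := by
    rw [hfac]
    field_simp
    ring
  rw [heq]
  rcases lt_or_gt_of_ne hk1 with hk | hk
  · have := rpow_one_add_lt_one_add_mul_self hge hne hk0 hk
    exact mul_pos_of_neg_of_neg (by linarith) (mul_neg_of_pos_of_neg hpos (by linarith))
  · have := one_add_mul_self_lt_rpow_one_add hge hne hk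
    exact mul_pos (by linarith) (mul_pos hpos (by linarith))

/-- A root on the positive side has derivative beyond the slope of the line. -/
lemma slope_lt_of_pos_root {k a b u : ℝ} (hk1 : k ≠ 1) (ha : 0 < (k - 1) * a)
    (hu : 0 < u) (hroot : u ^ (k - 1) * u = a + b * u) :
    0 < (k - 1) * (k * u ^ (k - 1) - b) := by
  have h1 : u * ((k - 1) * (u ^ (k - 1) - b)) = (k - 1) * a := by linear_combination (k - 1) * hroot
  have h2 : 0 < (k - 1) * (u ^ (k - 1) - b) := pos_of_mul_pos_right (h1 ▸ ha) hu.le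
  have h3 : 0 < (k - 1) ^ 2 * u ^ (k - 1) := by
    have := sub_ne_zero.mpr hk1
    positivity
  nlinarith

/-- A positive root satisfies `u ^ (k - 1) - b = a / u`. After multiplication by `k - 1` the left
side increases with `u` and the right side decreases. -/
lemma pos_root_unique {k a b u v : ℝ} (hk1 : k ≠ 1) (ha : 0 < (k - 1) * a) (hu : 0 < u)
    (hu' : u ^ (k - 1) * u = a + b * u) (hv' : v ^ (k - 1) * v = a + b * v) : ¬ u < v := by
  intro huv
  have hv : 0 < v := hu.trans huv
  have h1 : u * ((k - 1) * (u ^ (k - 1) - b)) = (k - 1) * a := by linear_combination (k - 1) * hu'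
  have h2 : v * ((k - 1) * (v ^ (k - 1) - b)) = (k - 1) * a := by linear_combination (k - 1) * hv'
  have h3 : 0 < (k - 1) * (u ^ (k - 1) - b) := pos_of_mul_pos_right (h1 ▸ ha) hu.le
  have h4 : (k - 1) * u ^ (k - 1) < (k - 1) * v ^ (k - 1) := by
    rcases lt_or_gt_of_ne hk1 with hk | hk
    · exact mul_lt_mul_of_neg_left (Real.rpow_lt_rpow_of_neg hu huv (by linarith)) (by linarith)
    · exact mul_lt_mul_of_pos_left (Real.rpow_lt_rpow hu.le huv (by linarith)) (by linarith)
  nlinarith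

/-- Of two distinct roots on the negative side, the larger one has derivative beyond the slope. -/
lemma slope_lt_of_neg_roots {k a b s t : ℝ} (hk0 : 0 < k) (hk1 : k ≠ 1) (hs : 0 < s) (hst : s < t)
    (hs' : s ^ (k - 1) * s = b * s - a) (ht' : t ^ (k - 1) * t = b * t - a) :
    0 < (k - 1) * (k * t ^ (k - 1) - b) := by
  have h := tangent_lt hk0 hk1 (hs.trans hst) hs hst.ne'
  have h1 : 0 < (t - s) * ((k - 1) * (k * t ^ (k - 1) - b)) := by
    convert h using 1
    rw [hs', ht']
    ring
  exact pos_of_mul_pos_right h1 (by linarith)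

/-- The companion for the root nearer to `0`. Together the two lemmas exclude three distinct
negative roots, since the middle one would have its slope on both sides of `b`. -/
lemma lt_slope_of_neg_roots {k a b s t : ℝ} (hk0 : 0 < k) (hk1 : k ≠ 1) (hs : 0 < s) (hst : s < t)
    (hs' : s ^ (k - 1) * s = b * s - a) (ht' : t ^ (k - 1) * t = b * t - a) :
    (k - 1) * (k * s ^ (k - 1) - b) < 0 := by
  have h := tangent_lt hk0 hk1 hs (hs.trans hst) hst.ne
  have h1 : 0 < (t - s) * -((k - 1) * (k * s ^ (k - 1) - b)) := by
    convert h using 1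
    rw [hs', ht']
    ring
  have := pos_of_mul_pos_right h1 (by linarith)
  linarith

lemma exists_pos_neg {x : Fin d → ℝ} (hx : x ∈ admissible d) : ∃ i j, 0 < x i ∧ x j < 0 := by
  obtain ⟨l, hl⟩ := Function.ne_iff.mp hx.1
  have h1 : ∃ i, 0 < x i := by
    by_contra! h
    have := (sum_eq_zero_iff_of_nonpos fun i _ => h i).mp hx.2 l (mem_univ l)
    exact hl this
  have h2 : ∃ i, x i < 0 := by
    by_contra! h
    have := (sum_eq_zero_iff_of_nonneg fun i _ => h i).mp hx.2 l (mem_univ l)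
    exact hl this
  obtain ⟨i, hi⟩ := h1
  obtain ⟨j, hj⟩ := h2
  exact ⟨i, j, hi, hj⟩

/-! ### Classification of extremal vectors -/

/-- Vectors satisfying both extremality conditions, whose Lagrange line passes through
the origin, are of edge type. -/
lemma equivalent_edgeVector_of_roots {k b : ℝ} {x : Fin d → ℝ} (hd : 2 ≤ d) (hk1 : k ≠ 1)
    (hb : 0 < b) (hx : x ∈ admissible d)
    (hroot : ∀ i, |x i| ^ (k - 1) * x i = b * x i)
    (hsecond : ∀ i j, i ≠ j → x i = x j → x i ≠ 0 → 0 ≤ (k - 1) * (b - k * |x i| ^ (k - 1))) :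
    Equivalent x (edgeVector d) := by
  have hval : ∀ i, x i ≠ 0 → |x i| ^ (k - 1) = b := fun i hi => mul_right_cancel₀ hi (hroot i)
  have hsq : 0 < (k - 1) ^ 2 := by
    have := sub_ne_zero.mpr hk1
    positivity
  -- At a nonzero root the second-order quantity equals `-(k - 1) ^ 2 * b`, which is negative.
  have hsimple : ∀ i j, i ≠ j → x i ≠ 0 → x i ≠ x j := fun i j hij hi h => by
    have := hsecond i j hij h hi
    rw [hval i hi] at this
    nlinarith [mul_pos hsq hb]
  have habs : ∀ i j, x i ≠ 0 → x j ≠ 0 → |x i| = |x j| := fun i j hi hj =>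
    (Real.rpow_left_inj (abs_nonneg _) (abs_nonneg _) (sub_ne_zero.mpr hk1)).mp
      ((hval i hi).trans (hval j hj).symm)
  obtain ⟨i, j, hi, hj⟩ := exists_pos_neg hx
  have hij : i ≠ j := by rintro rfl; linarith
  have hji : x j = -x i := by
    have := habs i j hi.ne' hj.ne
    rw [abs_of_pos hi, abs_of_neg hj] at this
    linarith
  refine equivalent_edgeVector hd hij hi.ne' hji fun l hli hlj => ?_
  by_contra hl
  rcases abs_eq_abs.mp (habs l i hl hi.ne') with h | h
  · exact hsimple l i hli hl h
  · exact hsimple l j hlj hl (h.trans hji.symm)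

/-- Extremal vectors whose Lagrange line does not pass through the origin are of vertex type. -/
lemma IsExtremal.equivalent_vertexVector {k a b : ℝ} {x : Fin d → ℝ} (hd : 4 ≤ d) (hk0 : 0 < k)
    (hk1 : k ≠ 1) (hx : IsExtremal (k + 1) x) (ha : 0 < (k - 1) * a)
    (hroot : ∀ i, |x i| ^ (k - 1) * x i = a + b * x i)
    (hsecond : ∀ i j, i ≠ j → x i = x j → x i ≠ 0 → 0 ≤ (k - 1) * (b - k * |x i| ^ (k - 1))) :
    Equivalent x (vertexVector d) := by
  have hd' : (4 : ℝ) ≤ d := by exact_mod_cast hd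
  have ha0 : a ≠ 0 := by rintro rfl; simp at ha
  have hne : ∀ i, x i ≠ 0 := fun i h => ha0 (by simpa [h, eq_comm] using hroot i)
  have hpr : ∀ i, 0 < x i → x i ^ (k - 1) * x i = a + b * x i := fun i hi => by
    simpa [abs_of_pos hi] using hroot i
  have hnr : ∀ i, x i < 0 → (-x i) ^ (k - 1) * (-x i) = b * (-x i) - a := fun i hi => by
    have := hroot i
    rw [abs_of_neg hi] at this
    linarith
  obtain ⟨i, j', hi, hj'⟩ := exists_pos_neg hx.1
  -- A second positive coordinate would equal `x i` by uniqueness of the positive root, and this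
  -- root may not be repeated.
  have hneg : ∀ l, l ≠ i → x l < 0 := fun l hl => by
    by_contra! h
    have hl0 : 0 < x l := lt_of_le_of_ne h (hne l).symm
    have heq : x l = x i := le_antisymm
      (not_lt.mp (pos_root_unique hk1 ha hi (hpr i hi) (hpr l hl0)))
      (not_lt.mp (pos_root_unique hk1 ha hl0 (hpr l hl0) (hpr i hi)))
    have h1 := hsecond l i hl heq (hne l)
    have h2 := slope_lt_of_pos_root hk1 ha hl0 (hpr l hl0)
    rw [abs_of_pos hl0] at h1
    linarith
  have : Nonempty (Fin d) := ⟨i⟩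
  obtain ⟨j, hj⟩ := Finite.exists_min x
  have hj0 : x j < 0 := (hj j').trans_lt hj'
  have hij : i ≠ j := by rintro rfl; linarith
  by_cases hall : ∀ l, l ≠ i → x l = x j
  · have hxi : x i = -x j * (d - 1) := by
      have h1 : ∀ l, x l = if l = i then x i else if l = j then x j else x j := fun l => by
        rcases eq_or_ne l i with rfl | hl
        · simp
        · simp [hl, hall l hl]
      have h2 := hx.1.2
      rw [sum_congr rfl fun l _ => h1 l, sum_ite_ite hij] at h2
      linarith
    exact ZeroSum.equivalent_vertexVector (neg_ne_zero.mpr hj0.ne) hxi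
      fun l hl => by rw [hall l hl, neg_neg]
  exfalso
  push Not at hall
  obtain ⟨j₁, hj₁i, hj₁⟩ := hall
  have hlt : x j < x j₁ := lt_of_le_of_ne (hj j₁) hj₁.symm
  have hj₁0 := hneg j₁ hj₁i
  -- The value `x j` is the negative root farther from `0`, so it is not repeated; any other
  -- negative coordinate different from `x j₁` would be a third negative root.
  have hrest : ∀ l, l ≠ i → l ≠ j → x l = x j₁ := fun l hli hlj => by
    have hl0 := hneg l hli
    have h1 : x j ≠ x l := fun h => by
      have h2 := hsecond j l hlj.symm h hj0.ne
      have h3 := slope_lt_of_neg_roots hk0 hk1 (neg_pos.mpr hj₁0) (neg_lt_neg hlt)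
        (hnr j₁ hj₁0) (hnr j hj0)
      rw [abs_of_neg hj0] at h2
      linarith
    have h2 : x j < x l := lt_of_le_of_ne (hj l) h1
    by_contra hne'
    rcases lt_or_gt_of_ne hne' with h | h
    · have h3 := slope_lt_of_neg_roots hk0 hk1 (neg_pos.mpr hj₁0) (neg_lt_neg h)
        (hnr j₁ hj₁0) (hnr l hl0)
      have h4 := lt_slope_of_neg_roots hk0 hk1 (neg_pos.mpr hl0) (neg_lt_neg h2)
        (hnr l hl0) (hnr j hj0)
      linarith
    · have h3 := slope_lt_of_neg_roots hk0 hk1 (neg_pos.mpr hl0) (neg_lt_neg h)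
        (hnr l hl0) (hnr j₁ hj₁0)
      have h4 := lt_slope_of_neg_roots hk0 hk1 (neg_pos.mpr hj₁0) (neg_lt_neg hlt)
        (hnr j₁ hj₁0) (hnr j hj0)
      linarith
  obtain ⟨s, hs⟩ : ∃ s, s = -x j₁ := ⟨_, rfl⟩
  have hs0 : 0 < s := by linarith
  obtain ⟨r, hr⟩ : ∃ r, r = -x j / s := ⟨_, rfl⟩
  have hxj : x j = -(s * r) := by rw [hr]; field_simp
  have hr1 : 1 < r := by rw [hr, one_lt_div hs0]; linarith
  have hxi : x i = s * (r + ((d : ℝ) - 2)) := by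
    have h1 : ∀ l, x l = if l = i then x i else if l = j then x j else x j₁ := fun l => by
      rcases eq_or_ne l i with rfl | hl
      · simp
      rcases eq_or_ne l j with rfl | hl'
      · simp [hl]
      · simp [hl, hl', hrest l hl hl']
    have h2 := hx.1.2
    rw [sum_congr rfl fun l _ => h1 l, sum_ite_ite hij] at h2
    rw [hxj, (by linarith : x j₁ = -s)] at h2
    linarith
  have hfam : x = fun l => s * familyVector i j r l := by
    funext l
    rcases eq_or_ne l i with rfl | hl
    · simp [familyVector, hxi]
    rcases eq_or_ne l j with rfl | hl'
    · simp [familyVector, hl, hxj]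
    · simp [familyVector, hl, hl', hrest l hl hl']
      linarith
  set m : ℝ := (d : ℝ) - 2 with hm
  have hr0 : 0 < r := by linarith
  have hrm : 0 < r + m := by linarith
  have hE : collinearityDefect k m r = 0 := by
    have e1 := hpr i hi
    have e2 := hnr j hj0
    have e3 := hnr j₁ hj₁0
    rw [← Real.rpow_add_one hi.ne', sub_add_cancel, hxi, Real.mul_rpow hs0.le hrm.le] at e1
    rw [← Real.rpow_add_one (by linarith), sub_add_cancel, hxj, neg_neg,
      Real.mul_rpow hs0.le hr0.le] at e2
    rw [← Real.rpow_add_one (by linarith), sub_add_cancel, ← hs] at e3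
    have hsk : s * s ^ k ≠ 0 := by positivity
    refine (mul_eq_zero.mp ?_).resolve_left hsk
    rw [collinearityDefect]
    -- The coefficients are the pairwise differences of the three coordinates, which eliminate `a`
    -- and `b`.
    linear_combination (s * (r + m + 1)) * e2 - (s * (r - 1)) * e1 - (s * (2 * r + m)) * e3
  have hbetter := exists_better_of_collinearityDefect_eq_zero hk0 hk1 (by linarith) hr1 hE
  have hext := hx.2 (familyVector i j (r + 1)) (sum_familyVector hij _)
  rw [hfam, powerSum_smul, sqSum_smul_rpow, powerSum_familyVector (by omega) _ hij hr0,
    powerSum_familyVector (by omega) _ hij (by linarith), sqSum_familyVector hij,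
    sqSum_familyVector hij, ← hm] at hext
  have hsq : 0 < |s| ^ (k + 1) := Real.rpow_pos_of_pos (abs_pos.mpr hs0.ne') _
  have h := mul_lt_mul_of_pos_left hbetter hsq
  have e : k + 1 - 2 = k - 1 := by ring
  rw [e] at hext
  linarith

lemma Equivalent.of_neg {x v : Fin d → ℝ} (h : Equivalent (-x) v) : Equivalent x v := by
  obtain ⟨t, ht, σ, hσ⟩ := h
  refine ⟨-t, neg_ne_zero.mpr ht, σ, fun i => ?_⟩
  have := hσ i
  simp only [Pi.neg_apply] at this
  linarith

/-- Extremal vectors are of edge type or of vertex type. -/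
theorem IsExtremal.equivalent {q : ℝ} {x : Fin d → ℝ} (hd : 4 ≤ d) (hq1 : 1 < q) (hq2 : q ≠ 2)
    (hx : IsExtremal q x) : Equivalent x (edgeVector d) ∨ Equivalent x (vertexVector d) := by
  obtain ⟨k, rfl⟩ : ∃ k, q = k + 1 := ⟨q - 1, by ring⟩
  have hk0 : 0 < k := by linarith
  have hk1 : k ≠ 1 := fun h => hq2 (by rw [h]; norm_num)
  have e : k + 1 - 2 = k - 1 := by ring
  set b := powerSum (k + 1) x / sqSum x with hb
  have hb0 : 0 < b := div_pos (powerSum_pos _ hx.1.1) (sqSum_pos hx.1.1)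
  obtain ⟨i₀, -⟩ := Function.ne_iff.mp hx.1.1
  set a := |x i₀| ^ (k - 1) * x i₀ - b * x i₀ with ha
  have hroot : ∀ i, |x i| ^ (k - 1) * x i = a + b * x i := fun i => by
    have := hx.lagrange hq1 hq2 i i₀
    rw [e, ← hb] at this
    rw [ha]
    linarith
  have hsecond : ∀ i j, i ≠ j → x i = x j → x i ≠ 0 →
      0 ≤ (k - 1) * (b - k * |x i| ^ (k - 1)) := fun i j hij hxij hxi => by
    have := hx.second_order hq1 hij hxij hxi
    rwa [e, ← hb, add_sub_cancel_right] at this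
  rcases lt_trichotomy ((k - 1) * a) 0 with h | h | h
  · right
    -- Passing to `-x` changes the sign of `a` and keeps `b`.
    refine Equivalent.of_neg (IsExtremal.equivalent_vertexVector hd hk0 hk1 hx.neg
      (a := -a) (b := b) (by linarith) (fun i => ?_) fun i j hij hxij hxi => ?_)
    · simp only [Pi.neg_apply, abs_neg]
      linarith [hroot i]
    · simp only [Pi.neg_apply, abs_neg] at hxij hxi ⊢
      exact hsecond i j hij (neg_injective hxij) (neg_ne_zero.mp hxi)
  · left
    have ha0 : a = 0 := (mul_eq_zero.mp h).resolve_left (sub_ne_zero.mpr hk1)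
    exact equivalent_edgeVector_of_roots (by omega) hk1 hb0 hx.1
      (fun i => by rw [hroot i, ha0, zero_add]) hsecond
  · right
    exact IsExtremal.equivalent_vertexVector hd hk0 hk1 hx h hroot hsecond

/-! ### The quotient of norms and its values at the two model vectors -/

lemma ratio_eq {q : ℝ} (hq : q ≠ 0) (x : Fin d → ℝ) :
    ratio q x = (powerSum q x / sqSum x ^ (q / 2)) ^ (1 / q) := by
  have h2 : lpQuasiNorm 2 x = sqSum x ^ (1 / 2 : ℝ) := by
    simp [lpQuasiNorm, sqSum]
  have h1 : 0 ≤ powerSum q x := sum_nonneg fun _ _ => Real.rpow_nonneg (abs_nonneg _) _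
  rw [ratio, h2, Real.div_rpow h1 (Real.rpow_nonneg (sqSum_nonneg x) _),
    ← Real.rpow_mul (sqSum_nonneg x)]
  congr 2
  field_simp

lemma ratio_le_ratio_iff {q : ℝ} (hq : 0 < q) {x y : Fin d → ℝ} (hx : x ≠ 0) (hy : y ≠ 0) :
    ratio q x ≤ ratio q y ↔
      powerSum q x * sqSum y ^ (q / 2) ≤ powerSum q y * sqSum x ^ (q / 2) := by
  have hx1 := powerSum_pos q hx
  have hy1 := powerSum_pos q hy
  have hx2 := Real.rpow_pos_of_pos (sqSum_pos hx) (q / 2)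
  have hy2 := Real.rpow_pos_of_pos (sqSum_pos hy) (q / 2)
  rw [ratio_eq hq.ne', ratio_eq hq.ne', Real.rpow_le_rpow_iff (by positivity) (by positivity)
    (by positivity), div_le_div_iff₀ hx2 hy2]

lemma isExtremal_of_ratio_le {q : ℝ} (hq : 2 < q) {x : Fin d → ℝ} (hx : x ∈ admissible d)
    (h : ∀ y ∈ admissible d, ratio q y ≤ ratio q x) : IsExtremal q x := by
  refine ⟨hx, fun y hy => mul_nonneg (by linarith) ?_⟩
  -- `IsExtremal` also quantifies over `y = 0`, where both products vanish because `q` and `q / 2`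
  -- are nonzero.
  rcases eq_or_ne y 0 with rfl | hy0
  · simp [powerSum, sqSum, Real.zero_rpow (by linarith : q ≠ 0),
      Real.zero_rpow (by linarith : q / 2 ≠ 0)]
  · exact sub_nonneg.mpr ((ratio_le_ratio_iff (by linarith) hy0 hx.1).mp (h y ⟨hy0, hy⟩))

lemma isExtremal_of_le_ratio {q : ℝ} (hq0 : 0 < q) (hq : q < 2) {x : Fin d → ℝ}
    (hx : x ∈ admissible d) (h : ∀ y ∈ admissible d, ratio q x ≤ ratio q y) : IsExtremal q x := by
  refine ⟨hx, fun y hy => mul_nonneg_of_nonpos_of_nonpos (by linarith) ?_⟩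
  rcases eq_or_ne y 0 with rfl | hy0
  · simp [powerSum, sqSum, Real.zero_rpow (by linarith : q ≠ 0),
      Real.zero_rpow (by linarith : q / 2 ≠ 0)]
  · exact sub_nonpos.mpr ((ratio_le_ratio_iff hq0 hx.1 hy0).mp (h y ⟨hy0, hy⟩))

lemma ratio_smul {q c : ℝ} (hq : 0 < q) (hc : c ≠ 0) (x : Fin d → ℝ) :
    ratio q (fun i => c * x i) = ratio q x := by
  have := Real.rpow_pos_of_pos (abs_pos.mpr hc) q
  rw [ratio_eq hq.ne', ratio_eq hq.ne', powerSum_smul, sqSum_smul_rpow,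
    mul_div_mul_left _ _ this.ne']

lemma Equivalent.ratio_eq {q : ℝ} (hq : 0 < q) {x v : Fin d → ℝ} (h : Equivalent x v) :
    ratio q x = ratio q v := by
  obtain ⟨t, ht, σ, hσ⟩ := h
  have hx : x = fun i => t * (v ∘ σ) i := funext hσ
  rw [hx, ratio_smul hq ht]
  simp only [ratio, lpQuasiNorm, Function.comp]
  rw [Equiv.sum_comp σ (fun i => |v i| ^ q), Equiv.sum_comp σ (fun i => |v i| ^ (2 : ℝ))]

lemma sum_comp_edgeVector (hd : 2 ≤ d) (φ : ℝ → ℝ) :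
    ∑ l, φ (edgeVector d l) = φ 1 + φ (-1) + ((d : ℝ) - 2) * φ 0 := by
  have hij : (⟨0, by omega⟩ : Fin d) ≠ ⟨1, by omega⟩ := by simp
  rw [← sum_ite_ite hij]
  refine sum_congr rfl fun l _ => ?_
  simp only [edgeVector, Fin.ext_iff]
  split_ifs <;> rfl

lemma sum_comp_vertexVector (hd : 2 ≤ d) (φ : ℝ → ℝ) :
    ∑ l, φ (vertexVector d l) = φ ((d : ℝ) - 1) + ((d : ℝ) - 1) * φ (-1) := by
  have hij : (⟨0, by omega⟩ : Fin d) ≠ ⟨1, by omega⟩ := by simp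
  have h := sum_ite_ite hij (φ ((d : ℝ) - 1)) (φ (-1)) (φ (-1))
  rw [(by ring : φ ((d : ℝ) - 1) + ((d : ℝ) - 1) * φ (-1) =
    φ ((d : ℝ) - 1) + φ (-1) + ((d : ℝ) - 2) * φ (-1)), ← h]
  refine sum_congr rfl fun l _ => ?_
  simp only [vertexVector, Fin.ext_iff]
  split_ifs <;> rfl

lemma edgeVector_mem (hd : 2 ≤ d) : edgeVector d ∈ admissible d := by
  refine ⟨fun h => ?_, ?_⟩
  · have := congrFun h ⟨0, by omega⟩
    simp [edgeVector] at this
  · have := sum_comp_edgeVector hd id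
    simpa using this

lemma vertexVector_mem (hd : 2 ≤ d) : vertexVector d ∈ admissible d := by
  refine ⟨fun h => ?_, ?_⟩
  · have := congrFun h ⟨1, by omega⟩
    simp [vertexVector] at this
  · have := sum_comp_vertexVector hd id
    simp only [id] at this
    rw [this]
    ring

lemma ratio_edgeVector (hd : 2 ≤ d) {q : ℝ} (hq : 0 < q) :
    ratio q (edgeVector d) = edgeValue q := by
  have h1 : powerSum q (edgeVector d) = 2 := by
    rw [powerSum, sum_comp_edgeVector hd (fun s => |s| ^ q)]
    simp [Real.zero_rpow hq.ne']
    norm_num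
  have h2 : sqSum (edgeVector d) = 2 := by
    rw [sqSum, sum_comp_edgeVector hd (fun s => s ^ 2)]
    norm_num
  have h3 : (2 : ℝ) / 2 ^ (q / 2) = 2 ^ (1 - q / 2) := by
    rw [Real.rpow_sub two_pos, Real.rpow_one]
  rw [ratio_eq hq.ne', h1, h2, h3, ← Real.rpow_mul two_pos.le, edgeValue]
  congr 1
  field_simp

lemma ratio_vertexVector (hd : 2 ≤ d) {q : ℝ} (hq : 0 < q) :
    ratio q (vertexVector d) = vertexValue d q := by
  have hd' : (2 : ℝ) ≤ d := by exact_mod_cast hd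
  have hn : 0 < (d : ℝ) - 1 := by linarith
  have h1 : powerSum q (vertexVector d) = ((d : ℝ) - 1) ^ q + ((d : ℝ) - 1) := by
    rw [powerSum, sum_comp_vertexVector hd (fun s => |s| ^ q)]
    simp [abs_of_pos hn]
  have h2 : sqSum (vertexVector d) = ((d : ℝ) - 1) * d := by
    rw [sqSum, sum_comp_vertexVector hd (fun s => s ^ 2)]
    ring
  have h3 : ((d : ℝ) - 1) ^ q = ((d : ℝ) - 1) ^ (q / 2) * ((d : ℝ) - 1) ^ (q / 2) := by
    rw [← Real.rpow_add hn, add_halves]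
  have h4 : ((d : ℝ) - 1) ^ (1 - q / 2) = ((d : ℝ) - 1) / ((d : ℝ) - 1) ^ (q / 2) := by
    rw [Real.rpow_sub hn, Real.rpow_one]
  have h5 := (Real.rpow_pos_of_pos hn (q / 2)).ne'
  rw [ratio_eq hq.ne', h1, h2, Real.mul_rpow hn.le (by linarith), vertexValue, h3, h4]
  congr 1
  field_simp

/-! ### Existence of extremal vectors -/

/-- The sphere of zero-sum vectors. -/
lemma isCompact_zeroSum_sphere (d : ℕ) :
    IsCompact {x : Fin d → ℝ | ∑ i, x i = 0 ∧ sqSum x = 1} := by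
  refine Metric.isCompact_of_isClosed_isBounded ?_ ?_
  · refine IsClosed.inter (isClosed_eq (by fun_prop) continuous_const)
      (isClosed_eq ?_ continuous_const)
    unfold sqSum
    fun_prop
  · refine (Metric.isBounded_closedBall (x := (0 : Fin d → ℝ)) (r := 1)).subset fun x hx => ?_
    rw [mem_closedBall_zero_iff, pi_norm_le_iff_of_nonneg zero_le_one]
    intro i
    rw [Real.norm_eq_abs, ← sq_le_one_iff_abs_le_one, ← hx.2]
    exact single_le_sum (f := fun i => x i ^ 2) (fun j _ => sq_nonneg _) (mem_univ i)

lemma exists_normalized {x : Fin d → ℝ} (hx : x ∈ admissible d) :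
    ∃ y : Fin d → ℝ, (∑ i, y i = 0 ∧ sqSum y = 1) ∧ ∀ q : ℝ, 0 < q → ratio q y = ratio q x := by
  have hD := sqSum_pos hx.1
  have hc : (Real.sqrt (sqSum x))⁻¹ ≠ 0 := by positivity
  refine ⟨fun i => (Real.sqrt (sqSum x))⁻¹ * x i, ⟨?_, ?_⟩, fun q hq => ratio_smul hq hc x⟩
  · rw [← mul_sum, hx.2, mul_zero]
  · rw [sqSum_smul, inv_pow, Real.sq_sqrt hD.le, inv_mul_cancel₀ hD.ne']

lemma mem_admissible_of_sqSum {x : Fin d → ℝ} (hx : ∑ i, x i = 0 ∧ sqSum x = 1) :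
    x ∈ admissible d := by
  refine ⟨?_, hx.1⟩
  rintro rfl
  simpa [sqSum] using hx.2

lemma continuousOn_ratio {q : ℝ} (hq : 0 < q) :
    ContinuousOn (ratio q) {x : Fin d → ℝ | ∑ i, x i = 0 ∧ sqSum x = 1} := by
  have h : Continuous fun x : Fin d → ℝ => powerSum q x ^ (1 / q) := by
    refine Continuous.rpow_const (continuous_finsetSum _ fun i _ =>
      ((continuous_apply i).abs.rpow_const fun _ => Or.inr hq.le)) fun _ => Or.inr (by positivity)
  refine h.continuousOn.congr fun x hx => ?_
  simp only [ratio_eq hq.ne', hx.2, Real.one_rpow, div_one]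

lemma exists_forall_ratio_le (hd : 2 ≤ d) {q : ℝ} (hq : 0 < q) :
    ∃ x ∈ admissible d, ∀ y ∈ admissible d, ratio q y ≤ ratio q x := by
  obtain ⟨w, hw, -⟩ := exists_normalized (edgeVector_mem hd)
  obtain ⟨z, hz, hmax⟩ := (isCompact_zeroSum_sphere d).exists_isMaxOn ⟨w, hw⟩ (continuousOn_ratio hq)
  refine ⟨z, mem_admissible_of_sqSum hz, fun y hy => ?_⟩
  obtain ⟨y', hy', h⟩ := exists_normalized hy
  rw [← h q hq]
  exact hmax hy'

lemma exists_forall_le_ratio (hd : 2 ≤ d) {q : ℝ} (hq : 0 < q) :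
    ∃ x ∈ admissible d, ∀ y ∈ admissible d, ratio q x ≤ ratio q y := by
  obtain ⟨w, hw, -⟩ := exists_normalized (edgeVector_mem hd)
  obtain ⟨z, hz, hmin⟩ := (isCompact_zeroSum_sphere d).exists_isMinOn ⟨w, hw⟩ (continuousOn_ratio hq)
  refine ⟨z, mem_admissible_of_sqSum hz, fun y hy => ?_⟩
  obtain ⟨y', hy', h⟩ := exists_normalized hy
  rw [← h q hq]
  exact hmin hy'

/-! ### Exponents at most one -/

/-- For exponents at most one, edge vectors are the only minimizers. -/
lemma edgeValue_le_ratio (hd : 2 ≤ d) {p : ℝ} (hp0 : 0 < p) (hp1 : p ≤ 1) {x : Fin d → ℝ}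
    (hx : x ∈ admissible d) :
    edgeValue p ≤ ratio p x ∧ (ratio p x = edgeValue p → Equivalent x (edgeVector d)) := by
  obtain ⟨i, j, hi, hj⟩ := exists_pos_neg hx
  have hij : i ≠ j := by rintro rfl; linarith
  obtain ⟨S, hS⟩ : ∃ S, ∑ l, |x l| = 2 * S := ⟨(∑ l, |x l|) / 2, by ring⟩
  have hle : ∀ l, |x l| ≤ S := fun l => by
    have h1 := add_sum_erase univ x (mem_univ l)
    have h2 := add_sum_erase univ (fun l => |x l|) (mem_univ l)
    have h3 := abs_sum_le_sum_abs x (univ.erase l)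
    rw [hx.2] at h1
    rw [hS] at h2
    rw [(by linarith : ∑ l ∈ univ.erase l, x l = -x l), abs_neg] at h3
    linarith
  have hS0 : 0 < S := (abs_pos.mpr hi.ne').trans_le (hle i)
  have hF : 2 * S ^ p ≤ powerSum p x := by
    -- Since `p - 1 ≤ 0` and `|x l| ≤ S`, the factor `|x l| ^ (p - 1)` is at least `S ^ (p - 1)`.
    have : ∀ l, S ^ (p - 1) * |x l| ≤ |x l| ^ p := fun l => by
      rcases eq_or_ne (x l) 0 with h | h
      · simp [h, Real.zero_rpow hp0.ne']
      · have h1 := Real.rpow_le_rpow_of_nonpos (abs_pos.mpr h) (hle l) (by linarith : p - 1 ≤ 0)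
        have h2 : |x l| ^ p = |x l| ^ (p - 1) * |x l| := by
          rw [← Real.rpow_add_one (abs_ne_zero.mpr h), sub_add_cancel]
        rw [h2]
        exact mul_le_mul_of_nonneg_right h1 (abs_nonneg _)
    have h1 := sum_le_sum fun l (_ : l ∈ univ) => this l
    rw [← mul_sum, hS] at h1
    have h2 : S ^ p = S ^ (p - 1) * S := by
      rw [← Real.rpow_add_one hS0.ne', sub_add_cancel]
    rw [h2]
    calc 2 * (S ^ (p - 1) * S) = S ^ (p - 1) * (2 * S) := by ring
      _ ≤ powerSum p x := h1
  have hgap : 2 * S ^ 2 - sqSum x = ∑ l, |x l| * (S - |x l|) := by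
    simp only [mul_sub, sum_sub_distrib, ← sum_mul, hS, sqSum, ← sq, sq_abs]
    ring
  have hterm : ∀ l ∈ univ, 0 ≤ |x l| * (S - |x l|) := fun l _ =>
    mul_nonneg (abs_nonneg _) (sub_nonneg.mpr (hle l))
  have hD : sqSum x ≤ 2 * S ^ 2 := by
    have := sum_nonneg hterm
    linarith
  have hSp : (2 * S ^ 2) ^ (p / 2) = 2 ^ (p / 2) * S ^ p := by
    rw [Real.mul_rpow two_pos.le (sq_nonneg S), ← Real.rpow_natCast, ← Real.rpow_mul hS0.le]
    congr 2
    push_cast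
    ring
  -- Taking `c = sqSum x` gives the inequality; taking `c = 2 * S ^ 2` gives the sharper bound that
  -- forces `sqSum x = 2 * S ^ 2` in the equality case.
  have hle' : ∀ c, sqSum x ≤ c → c ≤ 2 * S ^ 2 →
      2 * c ^ (p / 2) ≤ powerSum p x * 2 ^ (p / 2) := fun c hc hc' => by
    have h1 := Real.rpow_le_rpow ((sqSum_nonneg x).trans hc) hc' (by positivity : 0 ≤ p / 2)
    rw [hSp] at h1
    have h2 := mul_le_mul_of_nonneg_right hF (by positivity : (0 : ℝ) ≤ 2 ^ (p / 2))
    linarith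
  have hDpos := sqSum_pos hx.1
  have hE : edgeValue p = (2 / 2 ^ (p / 2)) ^ (1 / p) := by
    have h3 : (2 : ℝ) / 2 ^ (p / 2) = 2 ^ (1 - p / 2) := by
      rw [Real.rpow_sub two_pos, Real.rpow_one]
    rw [h3, ← Real.rpow_mul two_pos.le, edgeValue]
    congr 1
    field_simp
  have hDq := Real.rpow_pos_of_pos hDpos (p / 2)
  have h2q := Real.rpow_pos_of_pos (two_pos (α := ℝ)) (p / 2)
  have hFpos := powerSum_pos p hx.1
  refine ⟨?_, fun heq => ?_⟩
  · rw [hE, ratio_eq hp0.ne', Real.rpow_le_rpow_iff (by positivity) (by positivity) (by positivity),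
      div_le_div_iff₀ h2q hDq]
    exact hle' _ le_rfl hD
  · rw [hE, ratio_eq hp0.ne', Real.rpow_left_inj (by positivity) (by positivity) (by positivity),
      div_eq_div_iff hDq.ne' h2q.ne'] at heq
    have hDeq : sqSum x = 2 * S ^ 2 := by
      by_contra hne
      have h1 := Real.rpow_lt_rpow hDpos.le (lt_of_le_of_ne hD hne) (by positivity : 0 < p / 2)
      have h2 := hle' _ hD le_rfl
      linarith
    have hzero := (sum_eq_zero_iff_of_nonneg hterm).mp (by rw [← hgap, hDeq, sub_self])
    have habs : ∀ l, x l ≠ 0 → |x l| = S := fun l hl => by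
      have := (mul_eq_zero.mp (hzero l (mem_univ l))).resolve_left (abs_ne_zero.mpr hl)
      linarith
    have hxi := habs i hi.ne'
    have hxj := habs j hj.ne
    have hrest := sum_pair (f := fun l => |x l|) hij
    -- Coordinates `i` and `j` already use up the whole ℓ₁ norm `2 * S`.
    have htotal : ∑ l ∈ univ \ {i, j}, |x l| = 0 := by
      have := sum_sdiff (f := fun l => |x l|) (subset_univ ({i, j} : Finset (Fin d)))
      rw [hrest, hS, hxi, hxj] at this
      linarith
    rw [abs_of_pos hi] at hxi
    rw [abs_of_neg hj] at hxj
    refine equivalent_edgeVector hd hij hi.ne' (by linarith) fun l hli hlj => ?_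
    have := (sum_eq_zero_iff_of_nonneg fun l _ => abs_nonneg (x l)).mp htotal l (by simp [hli, hlj])
    exact abs_eq_zero.mp this

/-! ### Minima for `1 < p < 2` and maxima for `q > 2` -/

theorem isLeast_ratio (hd : 4 ≤ d) {p : ℝ} (hp1 : 1 < p) (hp2 : p < 2) :
    IsLeast (ratio p '' admissible d) (min (edgeValue p) (vertexValue d p)) ∧
      ∀ x ∈ admissible d,
        (ratio p x = min (edgeValue p) (vertexValue d p) ↔
          (edgeValue p ≤ vertexValue d p ∧ Equivalent x (edgeVector d)) ∨
          (vertexValue d p ≤ edgeValue p ∧ Equivalent x (vertexVector d))) := by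
  have hd2 : 2 ≤ d := by omega
  have hp0 : 0 < p := by linarith
  have he := ratio_edgeVector hd2 hp0
  have hv := ratio_vertexVector hd2 hp0
  obtain ⟨z, hz, hmin⟩ := exists_forall_le_ratio hd2 hp0
  have hval : ∀ x, Equivalent x (edgeVector d) ∨ Equivalent x (vertexVector d) →
      min (edgeValue p) (vertexValue d p) ≤ ratio p x := by
    rintro x (h | h)
    · rw [h.ratio_eq hp0, he]; exact min_le_left _ _
    · rw [h.ratio_eq hp0, hv]; exact min_le_right _ _
  have hzv : ratio p z = min (edgeValue p) (vertexValue d p) := by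
    refine le_antisymm (le_min ?_ ?_)
      (hval z ((isExtremal_of_le_ratio hp0 hp2 hz hmin).equivalent hd hp1 hp2.ne))
    · rw [← he]; exact hmin _ (edgeVector_mem hd2)
    · rw [← hv]; exact hmin _ (vertexVector_mem hd2)
  refine ⟨⟨⟨z, hz, hzv⟩, ?_⟩, fun x hx => ⟨fun h => ?_, ?_⟩⟩
  · rintro _ ⟨y, hy, rfl⟩
    exact hzv ▸ hmin y hy
  · have hx' := isExtremal_of_le_ratio hp0 hp2 hx fun y hy => by rw [h, ← hzv]; exact hmin y hy
    rcases hx'.equivalent hd hp1 hp2.ne with h' | h'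
    · left
      rw [h'.ratio_eq hp0, he] at h
      exact ⟨h ▸ min_le_right _ _, h'⟩
    · right
      rw [h'.ratio_eq hp0, hv] at h
      exact ⟨h ▸ min_le_left _ _, h'⟩
  · rintro (⟨h, h'⟩ | ⟨h, h'⟩)
    · rw [h'.ratio_eq hp0, he, min_eq_left h]
    · rw [h'.ratio_eq hp0, hv, min_eq_right h]

theorem isGreatest_ratio (hd : 4 ≤ d) {q : ℝ} (hq : 2 < q) :
    IsGreatest (ratio q '' admissible d) (max (edgeValue q) (vertexValue d q)) ∧
      ∀ x ∈ admissible d,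
        (ratio q x = max (edgeValue q) (vertexValue d q) ↔
          (vertexValue d q ≤ edgeValue q ∧ Equivalent x (edgeVector d)) ∨
          (edgeValue q ≤ vertexValue d q ∧ Equivalent x (vertexVector d))) := by
  have hd2 : 2 ≤ d := by omega
  have hq0 : 0 < q := by linarith
  have hq1 : 1 < q := by linarith
  have he := ratio_edgeVector hd2 hq0
  have hv := ratio_vertexVector hd2 hq0
  obtain ⟨z, hz, hmax⟩ := exists_forall_ratio_le hd2 hq0
  have hval : ∀ x, Equivalent x (edgeVector d) ∨ Equivalent x (vertexVector d) →
      ratio q x ≤ max (edgeValue q) (vertexValue d q) := by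
    rintro x (h | h)
    · rw [h.ratio_eq hq0, he]; exact le_max_left _ _
    · rw [h.ratio_eq hq0, hv]; exact le_max_right _ _
  have hzv : ratio q z = max (edgeValue q) (vertexValue d q) := by
    refine le_antisymm (hval z ((isExtremal_of_ratio_le hq hz hmax).equivalent hd hq1 hq.ne'))
      (max_le ?_ ?_)
    · rw [← he]; exact hmax _ (edgeVector_mem hd2)
    · rw [← hv]; exact hmax _ (vertexVector_mem hd2)
  refine ⟨⟨⟨z, hz, hzv⟩, ?_⟩, fun x hx => ⟨fun h => ?_, ?_⟩⟩
  · rintro _ ⟨y, hy, rfl⟩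
    exact hzv ▸ hmax y hy
  · have hx' := isExtremal_of_ratio_le hq hx fun y hy => by rw [h, ← hzv]; exact hmax y hy
    rcases hx'.equivalent hd hq1 hq.ne' with h' | h'
    · left
      rw [h'.ratio_eq hq0, he] at h
      exact ⟨h ▸ le_max_right _ _, h'⟩
    · right
      rw [h'.ratio_eq hq0, hv] at h
      exact ⟨h ▸ le_max_left _ _, h'⟩
  · rintro (⟨h, h'⟩ | ⟨h, h'⟩)
    · rw [h'.ratio_eq hq0, he, max_eq_left h]
    · rw [h'.ratio_eq hq0, hv, max_eq_right h]

end ZeroSum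

theorem theorem1p2 (d : ℕ) (hd : 4 ≤ d) :
    (∀ p : ℝ, 0 < p → p ≤ 1 →
      IsLeast (ZeroSum.ratio p '' ZeroSum.admissible d) (ZeroSum.edgeValue p) ∧
      ∀ x ∈ ZeroSum.admissible d,
        (ZeroSum.ratio p x = ZeroSum.edgeValue p ↔
          ZeroSum.Equivalent x (ZeroSum.edgeVector d))) ∧
    (∀ p : ℝ, 1 < p → p < 2 →
      IsLeast (ZeroSum.ratio p '' ZeroSum.admissible d)
        (min (ZeroSum.edgeValue p) (ZeroSum.vertexValue d p)) ∧
      ∀ x ∈ ZeroSum.admissible d,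
        (ZeroSum.ratio p x = min (ZeroSum.edgeValue p) (ZeroSum.vertexValue d p) ↔
          (ZeroSum.edgeValue p ≤ ZeroSum.vertexValue d p ∧
            ZeroSum.Equivalent x (ZeroSum.edgeVector d)) ∨
          (ZeroSum.vertexValue d p ≤ ZeroSum.edgeValue p ∧
            ZeroSum.Equivalent x (ZeroSum.vertexVector d)))) ∧
    (∀ q : ℝ, 2 < q →
      IsGreatest (ZeroSum.ratio q '' ZeroSum.admissible d)
        (max (ZeroSum.edgeValue q) (ZeroSum.vertexValue d q)) ∧
      ∀ x ∈ ZeroSum.admissible d,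
        (ZeroSum.ratio q x = max (ZeroSum.edgeValue q) (ZeroSum.vertexValue d q) ↔
          (ZeroSum.vertexValue d q ≤ ZeroSum.edgeValue q ∧
            ZeroSum.Equivalent x (ZeroSum.edgeVector d)) ∨
          (ZeroSum.edgeValue q ≤ ZeroSum.vertexValue d q ∧
            ZeroSum.Equivalent x (ZeroSum.vertexVector d)))) := by
  have hd2 : 2 ≤ d := by omega
  refine ⟨fun p hp0 hp1 => ⟨⟨⟨_, ZeroSum.edgeVector_mem hd2, ZeroSum.ratio_edgeVector hd2 hp0⟩, ?_⟩,
    fun x hx => ⟨(ZeroSum.edgeValue_le_ratio hd2 hp0 hp1 hx).2, fun h => ?_⟩⟩,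
    fun p hp1 hp2 => ZeroSum.isLeast_ratio hd hp1 hp2,
    fun q hq => ZeroSum.isGreatest_ratio hd hq⟩
  · rintro _ ⟨y, hy, rfl⟩
    exact (ZeroSum.edgeValue_le_ratio hd2 hp0 hp1 hy).1
  · rw [h.ratio_eq hp0, ZeroSum.ratio_edgeVector hd2 hp0]
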